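/- All systems are finite-dimensional. A bipartite measure $E$ is a family of real functions $E(X:Y)$ of the density matrices on $\mathcal H_X\otimes\mathcal H_Y$, one for each pair of systems $X,Y$. It is an entanglement monotone if it is non-negative, vanishes on separable states, and is non-increasing under LOCC (finite protocols of local measurements and classical communication, with Kraus operators $K_q$), either deterministically, $E(\sum_q K_q\rho K_q^\dagger)\le E(\rho)$, or on average, $\sum_{q:\,p_q>0} p_qE(K_q\rho K_q^\dagger/p_q)\le E(\rho)$ with $p_q=\operatorname{tr}(K_q^\dagger K_q\rho)$. Let $\tilde E$ be an entanglement monotone that is convex on the states of each pair of systems. For systems $X,Y$ let $\tilde E_{max}(X:Y)$ be the supremum of $\tilde E$ over the states of $X,Y$, and let $n=\dim\mathcal H_X\dim\mathcal H_Y$. For a state $\sigma$ of any finite system, with eigenvalues $\lambda_1\ge\lambda_2\ge\dots$ and rank $r$, put $$G_{X:Y}(\sigma)=\sup_{\{|i\rangle\}}\tilde E\Big(\sum_{i=1}^r\lambda_i|i\rangle\langle i|\Big)\ \text{ if } r\le n,\qquad G_{X:Y}(\sigma)=0\ \text{ otherwise,}$$ the supremum being over the orthonormal bases of $\mathcal H_X\otimes\mathcal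 H_Y$, and $S_{X:Y}(\sigma)=\tilde E_{max}(X:Y)-G_{X:Y}(\sigma)$. An entanglement monotone $E$ is said to be governed by $S_{X:Y}$ if, for every state $\rho_A$ of every finite system $A$, $$S_{X:Y}(\rho_A)=\max\{E(\rho):\ \operatorname{tr}_B\rho=\rho_A\},$$ the maximum being over the states $\rho$ of $A$ and any other finite system $B$. Then: 1. For $\mathcal H_{A_1},\mathcal H_{A_2}\neq0$, the maximum of $\tilde E(A_1:A_2)$ exists and is reached at every maximally entangled state of $A_1A_2$; so $\tilde E_{max}(A_1:A_2)$ is the value of $\tilde E$ there. 2. The convex roof $E^{cr}(\rho)=\inf\sum_kP_kS_{A_1:A_2}(\operatorname{tr}_B|\Psi_k\rangle\langle\Psi_k|)$, over the finite ensembles of unit vectors with $\sum_kP_k|\Psi_k\rangle\langle\Psi_k|=\rho$, is an entanglement monotone governed by $S_{A_1:A_2}$. 3. If $E$ is an entanglement monotone governed by $S_{A_1:A_2}$, then for every state $\rho$ of $A_1,A_2,B$ $$\tilde E(A_1:A_2)+E(A_1A_2:B)\le\tilde E_{max}(A_1:A_2).$$ 4. Let $A=A_1\dots A_N$, let $i$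 be one of the indices, write $A_{\bar i}$ for all the parts but $A_i$, and let $E$ be an entanglement monotone governed by $S_{A_i:A_{\bar i}}$. For every state $\rho$ of $A_1,\dots,A_N,B$ with $\sum_{k\ne i}\tilde E(A_i:A_k)\le\tilde E(A_i:A_{\bar i})$, $$\sum_{k\neq i}\tilde E(A_i:A_k)+E(A_1\dots A_N:B)\le\tilde E_{max}(A_i:A_{\bar i}).$$ 5. Let $N=3$, let $\tilde E$ be invariant under the exchange of the two parties, and let $\rho$ be a state of $A_1,A_2,A_3,B$ that satisfies $\sum_{k\ne i}\tilde E(A_i:A_k)\le\tilde E(A_i:A_{\bar i})$ for $i=1,2,3$. If $A_1,A_2,A_3$ have equal dimensions and $E$ is an entanglement monotone governed by $S_{A_1:A_2A_3}$, then $$\frac23\sum_{1\le k<l\le3}\tilde E(A_k:A_l)+E(A_1A_2A_3:B)\le\tilde E_{max}(A_1:A_2A_3).$$ For arbitrary dimensions, if $E_i$ is an entanglement monotone governed by $S_{A_i:A_{\bar i}}$ for $i=1,2,3$, then $$\frac23\sum_{1\le k<l\le3}\tilde E(A_k:A_l)+\frac13\sum_{i=1}^3E_i(A_1A_2A_3:B)\le\frac13\sum_{i=1}^3\tilde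 E_{max}(A_i:A_{\bar i}).$$ -/

import Mathlib

open scoped Kronecker ComplexOrder

noncomputable section

namespace Monogamy

/-! ### States -/

/-- `ρ` is a density matrix of the finite system with basis labels `κ`. -/
def IsState {κ : Type} [Fintype κ] (ρ : Matrix κ κ ℂ) : Prop :=
  ρ.PosSemidef ∧ ρ.trace = 1

/-- The rank-one operator `|ψ⟩⟨ψ|`. -/
def ketbra {κ : Type} (ψ : EuclideanSpace ℂ κ) : Matrix κ κ ℂ :=
  Matrix.of fun x y => ψ x * star (ψ y)

/-- The partial trace over the second factor. -/
def ptrace {κ μ : Type} [Fintype μ] (ρ : Matrix (κ × μ) (κ × μ) ℂ) : Matrix κ κ ℂ :=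
  Matrix.of fun x y => ∑ z, ρ (x, z) (y, z)

/-- Separable states: convex combinations of product states. -/
def IsSeparable {α β : Type} [Fintype α] [Fintype β]
    (ρ : Matrix (α × β) (α × β) ℂ) : Prop :=
  ρ ∈ convexHull ℝ {σ : Matrix (α × β) (α × β) ℂ |
    ∃ (σA : Matrix α α ℂ) (σB : Matrix β β ℂ), IsState σA ∧ IsState σB ∧ σ = σA ⊗ₖ σB}

/-- Maximally entangled (pure) states: `|Φ⟩ = d^{-1/2} ∑ᵢ |aᵢ⟩|bᵢ⟩` with orthonormal
families `(aᵢ)`, `(bᵢ)` of `d = min (dim α) (dim β)` vectors. -/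
def IsMaximallyEntangled {α β : Type} [Fintype α] [Fintype β]
    (Φ : Matrix (α × β) (α × β) ℂ) : Prop :=
  ∃ (a : Fin (min (Fintype.card α) (Fintype.card β)) → EuclideanSpace ℂ α)
    (b : Fin (min (Fintype.card α) (Fintype.card β)) → EuclideanSpace ℂ β),
    Orthonormal ℂ a ∧ Orthonormal ℂ b ∧
    Φ = ketbra (WithLp.toLp 2 fun x : α × β =>
      ((Real.sqrt (min (Fintype.card α) (Fintype.card β) : ℕ))⁻¹ : ℂ) *
        ∑ i, a i x.1 * b i x.2)

/-! ### LOCC and entanglement monotones -/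

/-- `IsLOCC K`: the finite family of Kraus operators `K i`, from the bipartite system `α : β` to
the bipartite systems `outA i : outB i`, is implemented by local operations and classical
communication. A protocol is a finite tree: either nothing is done, or one of the two parties
makes a local measurement with Kraus operators `M j`, tells the outcome `j` to the other party,
and they go on with an LOCC protocol that may depend on `j`. -/
inductive IsLOCC : ∀ {α β : Type} [Fintype α] [DecidableEq α] [Fintype β] [DecidableEq β]
    {q : Type} {outA outB : q → Type}, (∀ i, Matrix (outA i × outB i) (α × β) ℂ) → Prop
  | nothing (α β : Type) [Fintype α] [DecidableEq α] [Fintype β] [DecidableEq β] :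
      IsLOCC (q := Unit) (outA := fun _ => α) (outB := fun _ => β)
        (fun _ => (1 : Matrix (α × β) (α × β) ℂ))
  | alice {α β : Type} [Fintype α] [DecidableEq α] [Fintype β] [DecidableEq β]
      {r : Type} [Fintype r] {γ : r → Type} [∀ j, Fintype (γ j)] [∀ j, DecidableEq (γ j)]
      (M : ∀ j, Matrix (γ j) α ℂ) (hM : ∑ j, (M j).conjTranspose * M j = 1)
      {s : r → Type} {outA outB : ∀ j, s j → Type}
      (K : ∀ j, ∀ i : s j, Matrix (outA j i × outB j i) (γ j × β) ℂ)
      (hK : ∀ j, IsLOCC (K j)) :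
      IsLOCC (q := Σ j, s j) (outA := fun x => outA x.1 x.2) (outB := fun x => outB x.1 x.2)
        (fun x => K x.1 x.2 * (M x.1 ⊗ₖ (1 : Matrix β β ℂ)))
  | bob {α β : Type} [Fintype α] [DecidableEq α] [Fintype β] [DecidableEq β]
      {r : Type} [Fintype r] {γ : r → Type} [∀ j, Fintype (γ j)] [∀ j, DecidableEq (γ j)]
      (M : ∀ j, Matrix (γ j) β ℂ) (hM : ∑ j, (M j).conjTranspose * M j = 1)
      {s : r → Type} {outA outB : ∀ j, s j → Type}
      (K : ∀ j, ∀ i : s j, Matrix (outA j i × outB j i) (α × γ j) ℂ)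
      (hK : ∀ j, IsLOCC (K j)) :
      IsLOCC (q := Σ j, s j) (outA := fun x => outA x.1 x.2) (outB := fun x => outB x.1 x.2)
        (fun x => K x.1 x.2 * ((1 : Matrix α α ℂ) ⊗ₖ M x.1))

/-- A family of real functions of bipartite states, one for each pair of finite systems. Only the
values at density matrices matter: every condition below concerns density matrices only. -/
abbrev BipartiteMeasure : Type 1 :=
  ∀ (α β : Type) [Fintype α] [DecidableEq α] [Fintype β] [DecidableEq β],
    Matrix (α × β) (α × β) ℂ → ℝ

/-- No increase under deterministic LOCC transformations `ρ ↦ ∑ K_q ρ K_q†`. -/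
def DeterministicallyMonotone (E : BipartiteMeasure) : Prop :=
  ∀ (α β α' β' : Type) [Fintype α] [DecidableEq α] [Fintype β] [DecidableEq β]
    [Fintype α'] [DecidableEq α'] [Fintype β'] [DecidableEq β']
    (q : Type) [Fintype q] (K : q → Matrix (α' × β') (α × β) ℂ),
    IsLOCC (outA := fun _ => α') (outB := fun _ => β') K →
    ∀ ρ : Matrix (α × β) (α × β) ℂ, IsState ρ →
      E α' β' (∑ i, K i * ρ * (K i).conjTranspose) ≤ E α β ρ

/-- No increase on average under LOCC measurements: `∑ p_q E(K_q ρ K_q† / p_q) ≤ E(ρ)` with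
`p_q = tr (K_q† K_q ρ)`; outcomes with `p_q = 0` contribute nothing. -/
def MonotoneOnAverage (E : BipartiteMeasure) : Prop :=
  ∀ (α β : Type) [Fintype α] [DecidableEq α] [Fintype β] [DecidableEq β]
    (q : Type) [Fintype q] (outA outB : q → Type)
    [∀ i, Fintype (outA i)] [∀ i, DecidableEq (outA i)]
    [∀ i, Fintype (outB i)] [∀ i, DecidableEq (outB i)]
    (K : ∀ i, Matrix (outA i × outB i) (α × β) ℂ), IsLOCC K →
    ∀ ρ : Matrix (α × β) (α × β) ℂ, IsState ρ →
      ∑ i, ((K i).conjTranspose * K i * ρ).trace.re *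
        E (outA i) (outB i)
          ((((K i).conjTranspose * K i * ρ).trace.re)⁻¹ • (K i * ρ * (K i).conjTranspose))
        ≤ E α β ρ

/-- Entanglement monotones: non-negative, zero at separable states, and non-increasing under
LOCC, either deterministically or on average. -/
structure IsEntanglementMonotone (E : BipartiteMeasure) : Prop where
  nonneg : ∀ (α β : Type) [Fintype α] [DecidableEq α] [Fintype β] [DecidableEq β]
    (ρ : Matrix (α × β) (α × β) ℂ), IsState ρ → 0 ≤ E α β ρ
  separable : ∀ (α β : Type) [Fintype α] [DecidableEq α] [Fintype β] [DecidableEq β]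
    (ρ : Matrix (α × β) (α × β) ℂ), IsSeparable ρ → E α β ρ = 0
  monotone : DeterministicallyMonotone E ∨ MonotoneOnAverage E

/-- Convexity, for each pair of systems. -/
def IsConvexMeasure (E : BipartiteMeasure) : Prop :=
  ∀ (α β : Type) [Fintype α] [DecidableEq α] [Fintype β] [DecidableEq β],
    ConvexOn ℝ {ρ : Matrix (α × β) (α × β) ℂ | IsState ρ} (E α β)

/-- Invariance under the exchange of the two parties. -/
def IsSymmetricMeasure (E : BipartiteMeasure) : Prop :=
  ∀ (α β : Type) [Fintype α] [DecidableEq α] [Fintype β] [DecidableEq β]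
    (ρ : Matrix (α × β) (α × β) ℂ), IsState ρ →
    E β α (ρ.submatrix Prod.swap Prod.swap) = E α β ρ

/-! ### The entropy of a bipartite measure and the monotones it governs -/

/-- The eigenvalues `λ₀ ≥ λ₁ ≥ …` of a Hermitian matrix, followed by zeros. -/
def eig {κ : Type} [Fintype κ] [DecidableEq κ] (ρ : Matrix κ κ ℂ) (i : ℕ) : ℝ :=
  open Classical in
  if h : ρ.IsHermitian ∧ i < Fintype.card κ then h.1.eigenvalues₀ ⟨i, h.2⟩ else 0

/-- The supremum of the measure `R` over the states of `α : β`. -/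
def Rsup (R : BipartiteMeasure) (α β : Type) [Fintype α] [DecidableEq α]
    [Fintype β] [DecidableEq β] : ℝ :=
  sSup {x | ∃ ρ : Matrix (α × β) (α × β) ℂ, IsState ρ ∧ x = R α β ρ}

/-- `G(ρ) = sup R(∑ᵢ λᵢ(ρ) |i⟩⟨i|)` over the orthonormal bases `|i⟩` of the Hilbert space of
`α : β` if the rank of `ρ` is at most its dimension `n`, and `G(ρ) = 0` otherwise. Here `ρ` is
a state of any finite system. (The eigenvalues after the rank of `ρ` are zero, so the sum
may run over all `n` vectors.) -/
def entG (R : BipartiteMeasure) (α β : Type) [Fintype α] [DecidableEq α]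
    [Fintype β] [DecidableEq β] {κ : Type} [Fintype κ] [DecidableEq κ]
    (ρ : Matrix κ κ ℂ) : ℝ :=
  if ρ.rank ≤ Fintype.card (α × β) then
    sSup {x | ∃ b : OrthonormalBasis (Fin (Fintype.card (α × β))) ℂ (EuclideanSpace ℂ (α × β)),
      x = R α β (∑ i : Fin (Fintype.card (α × β)), eig ρ i • ketbra (b i))}
  else 0

/-- The entropy `S(ρ) = R^sup - G(ρ)` of a state of any finite system. -/
def entS (R : BipartiteMeasure) (α β : Type) [Fintype α] [DecidableEq α]
    [Fintype β] [DecidableEq β] {κ : Type} [Fintype κ] [DecidableEq κ]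
    (ρ : Matrix κ κ ℂ) : ℝ :=
  Rsup R α β - entG R α β ρ

/-- `E` and the entropy `S` of `R` on `α : β` obey `S(ρ_A) = max {E(ρ) | tr_B ρ = ρ_A}` for every
state `ρ_A` of every finite system `A`; the maximum is over the states of `A` and any other
finite system `B`. -/
def IsGovernedBy (E R : BipartiteMeasure) (α β : Type) [Fintype α] [DecidableEq α]
    [Fintype β] [DecidableEq β] : Prop :=
  ∀ (κ : Type) [Fintype κ] [DecidableEq κ] (ρA : Matrix κ κ ℂ), IsState ρA →
    IsGreatest {x | ∃ (μ : Type) (_ : Fintype μ) (_ : DecidableEq μ)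
      (ρ : Matrix (κ × μ) (κ × μ) ℂ), IsState ρ ∧ ptrace ρ = ρA ∧ x = E κ μ ρ}
      (entS R α β ρA)

/-- The convex roof `inf ∑ P_k S(tr_B |Ψ_k⟩⟨Ψ_k|)` over the ensembles of unit vectors with
`∑ P_k |Ψ_k⟩⟨Ψ_k| = ρ`. -/
def convexRoof (R : BipartiteMeasure) (α β : Type) [Fintype α] [DecidableEq α]
    [Fintype β] [DecidableEq β] : BipartiteMeasure :=
  fun κ μ _ _ _ _ ρ =>
    sInf {x | ∃ (m : ℕ) (P : Fin m → ℝ) (Ψ : Fin m → EuclideanSpace ℂ (κ × μ)),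
      (∀ k, 0 ≤ P k) ∧ (∀ k, ‖Ψ k‖ = 1) ∧ ∑ k, P k • ketbra (Ψ k) = ρ ∧
      x = ∑ k, P k * entS R α β (ptrace (ketbra (Ψ k)))}

/-! ### Systems with several parts -/

/-- The system formed by all the parts but the part `i`. -/
abbrev Rest {N : ℕ} (α : Fin N → Type) (i : Fin N) : Type :=
  ∀ k : {k : Fin N // k ≠ i}, α k

/-- A state of the parts `α k`, seen as a state of the bipartite system `part i : the rest`. -/
def splitAt {N : ℕ} {α : Fin N → Type} (ρ : Matrix (∀ k, α k) (∀ k, α k) ℂ) (i : Fin N) :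
    Matrix (α i × Rest α i) (α i × Rest α i) ℂ :=
  ρ.submatrix (Equiv.piSplitAt i α).symm (Equiv.piSplitAt i α).symm

/-- The relabelling of `part i : the rest` as `(part i, part k)` together with the other parts. -/
def pairEquiv {N : ℕ} (α : Fin N → Type) (i : Fin N) (k : {k : Fin N // k ≠ i}) :
    (α i × α k) × (∀ l : {l : {k : Fin N // k ≠ i} // l ≠ k}, α l) ≃ α i × Rest α i :=
  (Equiv.prodAssoc _ _ _).trans
    (Equiv.prodCongr (Equiv.refl _)
      (Equiv.piSplitAt k (fun l : {k : Fin N // k ≠ i} => α l)).symm)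

/-- The reduced state of the two parts `i` and `k ≠ i`. -/
def pairState {N : ℕ} {α : Fin N → Type} [∀ k, Fintype (α k)]
    (ρ : Matrix (∀ k, α k) (∀ k, α k) ℂ) (i : Fin N) (k : {k : Fin N // k ≠ i}) :
    Matrix (α i × α k) (α i × α k) ℂ :=
  ptrace ((splitAt ρ i).submatrix (pairEquiv α i k) (pairEquiv α i k))

/-- The usual monogamy inequality `∑_{k ≠ i} E(A_i : A_k) ≤ E(A_i : all the other parts)`, at the
state `ρ`. -/
def UsualMonogamyAt (E : BipartiteMeasure) {N : ℕ} {α : Fin N → Type} [∀ k, Fintype (α k)]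
    [∀ k, DecidableEq (α k)] (ρ : Matrix (∀ k, α k) (∀ k, α k) ℂ) (i : Fin N) : Prop :=
  ∑ k : {k : Fin N // k ≠ i}, E (α i) (α k) (pairState ρ i k) ≤
    E (α i) (Rest α i) (splitAt ρ i)

end Monogamy

end

/-! The key is a description of `entG` without bases (`entG_eq`): `G(σ)` is the supremum of the
measure over all `V σ V†` with `V` isometric on the support of `σ`. If `σ` already lives on a system
identified with `α × β`, the identification is one such `V`, so the measure of `σ` is at most `G(σ)`
(`relabel_le_entG`). A governed `E` satisfies `E ≤ S = Rsup - G` at the marginal, and adding the two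
bounds gives monogamy (`IsGovernedBy.add_le`). The inequalities for several parts follow by
inserting the usual monogamy relation and, for three parts, averaging over the distinguished part.

The maximum is reached at maximally entangled states because LOCC takes such a state to any pure
state with certainty (`IsEntanglementMonotone.ketbra_le`); convexity then covers mixed states.

For the convex roof, two properties of `S` matter. It depends only on the nonzero spectrum, hence
agrees on the two marginals of a pure state (`homS_mul_conjTranspose`). It is concave
(`entG_sum_le`, `sum_homS_le`): an isometry on the support of a mixture is one on the support of
each component, so convexity of the measure passes to `G`. A local measurement preserves on average
the marginal of the other party, so concavity gives monotonicity on pure states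
(`IsLOCC.sum_homS_le`), and ensembles carry it to mixed states. Purifications attain the governed
maximum, and concavity is the matching upper bound. -/

noncomputable section

namespace Monogamy

open Matrix

section Spectrum

set_option linter.unusedSectionVars false

variable {κ μ ν : Type} [Fintype κ] [Fintype μ] [Fintype ν]

/-! ### Positive semidefinite matrices and states -/

lemma posSemidef_sum {ι : Type} (s : Finset ι) {σ : ι → Matrix κ κ ℂ}
    (h : ∀ j ∈ s, (σ j).PosSemidef) : (∑ j ∈ s, σ j).PosSemidef :=
  Finset.sum_induction σ Matrix.PosSemidef (fun _ _ ha hb => ha.add hb) Matrix.PosSemidef.zero h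

lemma posSemidef_real_smul {σ : Matrix κ κ ℂ} (h : σ.PosSemidef) {c : ℝ} (hc : 0 ≤ c) :
    (c • σ).PosSemidef := by
  have : c • σ = (c : ℂ) • σ := by ext; simp
  rw [this]
  exact h.smul (by exact_mod_cast hc)

lemma trace_eq_re {σ : Matrix κ κ ℂ} (h : σ.PosSemidef) : σ.trace = (σ.trace.re : ℂ) := by
  have := (Complex.le_def.1 h.trace_nonneg).2
  apply Complex.ext <;> simp_all

lemma trace_re_nonneg {σ : Matrix κ κ ℂ} (h : σ.PosSemidef) : 0 ≤ σ.trace.re :=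
  (Complex.le_def.1 h.trace_nonneg).1

lemma eq_zero_of_trace_re {σ : Matrix κ κ ℂ} (h : σ.PosSemidef) (h0 : σ.trace.re = 0) :
    σ = 0 := by
  rw [← h.trace_eq_zero_iff, trace_eq_re h, h0]; simp

lemma re_trace_real_smul (c : ℝ) (σ : Matrix κ κ ℂ) : (c • σ).trace.re = c * σ.trace.re := by
  rw [Matrix.trace_smul]; simp

lemma isState_inv_smul {σ : Matrix κ κ ℂ} (h : σ.PosSemidef) (h0 : σ.trace.re ≠ 0) :
    IsState (σ.trace.re⁻¹ • σ) := by
  have hp := posSemidef_real_smul h (inv_nonneg.2 (trace_re_nonneg h))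
  refine ⟨hp, ?_⟩
  rw [trace_eq_re hp, re_trace_real_smul, inv_mul_cancel₀ h0]; simp

lemma IsState.trace_re {σ : Matrix κ κ ℂ} (h : IsState σ) : σ.trace.re = 1 := by
  rw [h.2]; simp

lemma IsState.nonempty {σ : Matrix κ κ ℂ} (h : IsState σ) : Nonempty κ := by
  by_contra hk
  have := not_nonempty_iff.1 hk
  have h2 := h.2
  simp [Matrix.trace] at h2

lemma posSemidef_ketbra (ψ : EuclideanSpace ℂ κ) : (ketbra ψ).PosSemidef :=
  Matrix.posSemidef_vecMulVec_self_star (ψ : κ → ℂ)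

lemma trace_re_ketbra (ψ : EuclideanSpace ℂ κ) : (ketbra ψ).trace.re = ‖ψ‖ ^ 2 := by
  rw [EuclideanSpace.norm_sq_eq]
  simp only [Matrix.trace, Matrix.diag, ketbra, Matrix.of_apply, Complex.re_sum]
  refine Finset.sum_congr rfl fun i _ => ?_
  rw [← Complex.normSq_eq_norm_sq, Complex.star_def, Complex.mul_conj, Complex.ofReal_re]

lemma isState_ketbra {ψ : EuclideanSpace ℂ κ} (h : ‖ψ‖ = 1) : IsState (ketbra ψ) := by
  refine ⟨posSemidef_ketbra ψ, ?_⟩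
  rw [trace_eq_re (posSemidef_ketbra ψ), trace_re_ketbra, h]; simp

lemma ketbra_mulVec (K : Matrix μ κ ℂ) (ψ : EuclideanSpace ℂ κ) :
    ketbra (WithLp.toLp 2 (K *ᵥ ψ.ofLp)) = K * ketbra ψ * Kᴴ := by
  change vecMulVec (K *ᵥ ψ.ofLp) (star (K *ᵥ ψ.ofLp)) = K * vecMulVec ψ.ofLp (star ψ.ofLp) * Kᴴ
  rw [Matrix.mul_vecMulVec, Matrix.vecMulVec_mul, Matrix.star_mulVec]

lemma ketbra_real_smul (c : ℝ) (ψ : EuclideanSpace ℂ κ) :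
    ketbra (c • ψ) = (c ^ 2) • ketbra ψ := by
  ext x y
  simp [ketbra]
  ring

/-! ### The spectral decomposition on the support -/

variable [DecidableEq κ] [DecidableEq μ] [DecidableEq ν]

/-- The eigenvalues are nonnegative and decreasing, so the nonzero ones form an initial segment,
whose length is the rank. -/
lemma eig_pos_iff {ρ : Matrix κ κ ℂ} (h : ρ.PosSemidef) (i : ℕ) :
    (i < ρ.rank → 0 < eig ρ i) ∧ (ρ.rank ≤ i → eig ρ i = 0) := by
  classical
  set N := Fintype.card κ
  set l : Fin N → ℝ := h.1.eigenvalues₀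
  let e : κ ≃ Fin N := (Fintype.equivOfCardEq (Fintype.card_fin _)).symm
  have hnn : ∀ j, 0 ≤ l j := fun j => by
    have := h.eigenvalues_nonneg (e.symm j)
    simpa [Matrix.IsHermitian.eigenvalues, e] using this
  have hrank : ρ.rank = (Finset.univ.filter fun j : Fin N => l j ≠ 0).card := by
    rw [h.1.rank_eq_card_non_zero_eigs, ← Fintype.card_subtype]
    exact Fintype.card_congr (e.subtypeEquiv fun a => Iff.rfl)
  have hanti : Antitone l := h.1.eigenvalues₀_antitone
  have heig : ∀ hi : i < N, eig ρ i = l ⟨i, hi⟩ := fun hi => by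
    rw [eig, dif_pos ⟨h.1, hi⟩]
  constructor
  · intro hi
    have hN : ρ.rank ≤ N := ρ.rank_le_card_width
    rw [heig (by omega)]
    by_contra hneg
    have h0 : l ⟨i, by omega⟩ = 0 := le_antisymm (not_lt.1 hneg) (hnn _)
    have : (Finset.univ.filter fun j : Fin N => l j ≠ 0) ⊆ Finset.Iio ⟨i, by omega⟩ := by
      intro j hj
      rw [Finset.mem_Iio]
      by_contra hj'
      have := hanti (not_lt.1 hj')
      rw [h0] at this
      exact (Finset.mem_filter.1 hj).2 (le_antisymm this (hnn j))
    have := Finset.card_le_card this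
    rw [← hrank, Fin.card_Iio] at this
    simp at this; omega
  · intro hi
    by_cases hN : i < N
    · rw [heig hN]
      by_contra h0
      have : Finset.Iic ⟨i, hN⟩ ⊆ (Finset.univ.filter fun j : Fin N => l j ≠ 0) := by
        intro j hj
        have := hanti (Finset.mem_Iic.1 hj)
        have := (hnn ⟨i, hN⟩).lt_of_ne' h0
        exact Finset.mem_filter.2 ⟨Finset.mem_univ _, by linarith⟩
      have := Finset.card_le_card this
      rw [← hrank, Fin.card_Iic] at this
      simp at this; omega
    · rw [eig, dif_neg]; exact fun h' => hN h'.2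

/-- The spectral decomposition of a positive semidefinite matrix on its support. -/
lemma exists_spectral {ρ : Matrix κ κ ℂ} (h : ρ.PosSemidef) :
    ∃ E : Matrix κ (Fin ρ.rank) ℂ, Eᴴ * E = 1 ∧
      ρ = E * diagonal (fun i : Fin ρ.rank => (eig ρ i : ℂ)) * Eᴴ := by
  classical
  set U : Matrix κ κ ℂ := (h.1.eigenvectorUnitary : Matrix κ κ ℂ)
  let e : κ ≃ Fin (Fintype.card κ) := (Fintype.equivOfCardEq (Fintype.card_fin _)).symm
  have hr : ρ.rank ≤ Fintype.card κ := ρ.rank_le_card_width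
  let f : Fin ρ.rank → κ := fun i => e.symm (Fin.castLE hr i)
  have hf : Function.Injective f := e.symm.injective.comp (Fin.castLE_injective hr)
  have heig : ∀ k, h.1.eigenvalues k = eig ρ (e k) := fun k => by
    simp [eig, h.1, Matrix.IsHermitian.eigenvalues, e]
  have hUU : Uᴴ * U = 1 := Matrix.mem_unitaryGroup_iff'.1 h.1.eigenvectorUnitary.2
  refine ⟨U.submatrix id f, ?_, ?_⟩
  · rw [Matrix.conjTranspose_submatrix, ← Matrix.submatrix_mul _ _ f id f Function.bijective_id,
      hUU, Matrix.submatrix_one _ hf]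
  · have hs : ρ = U * diagonal (fun k => (h.1.eigenvalues k : ℂ)) * Uᴴ := by
      conv_lhs => rw [h.1.spectral_theorem, Unitary.conjStarAlgAut_apply]
      rfl
    conv_lhs => rw [hs]
    ext x y
    rw [Matrix.mul_apply, Matrix.mul_apply]
    symm
    apply Fintype.sum_of_injective f hf
    · intro k hk
      have : eig ρ (e k) = 0 := by
        apply (eig_pos_iff h _).2
        by_contra hlt
        exact hk ⟨⟨e k, not_le.1 hlt⟩, by simp [f]⟩
      simp [Matrix.mul_diagonal, heig, this]
    · intro i
      simp [Matrix.mul_diagonal, heig, f]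

lemma exists_eq_mul_conjTranspose {ρ : Matrix κ κ ℂ} (h : ρ.PosSemidef) :
    ∃ B : Matrix κ (Fin ρ.rank) ℂ, ρ = B * Bᴴ := by
  obtain ⟨E, -, hE⟩ := exists_spectral h
  refine ⟨E * diagonal (fun i : Fin ρ.rank => (Real.sqrt (eig ρ i) : ℂ)), ?_⟩
  rw [Matrix.conjTranspose_mul, Matrix.diagonal_conjTranspose, Matrix.mul_assoc,
    ← Matrix.mul_assoc (diagonal _) (diagonal _), Matrix.diagonal_mul_diagonal,
    ← Matrix.mul_assoc]
  conv_lhs => rw [hE]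
  congr 3
  ext i
  simp only [Pi.star_apply, Complex.star_def, Complex.conj_ofReal]
  rw [← Complex.ofReal_mul, Real.mul_self_sqrt ((eig_pos_iff h i).1 i.2).le]

/-- With `σ = B B†` the hypothesis reads `(Q B)(Q B)† = 0`, which forces `Q B = 0`. -/
lemma mul_eq_zero_of_mul_mul_conjTranspose {σ : Matrix κ κ ℂ} (h : σ.PosSemidef)
    {Q : Matrix μ κ ℂ} (hQ : Q * σ * Qᴴ = 0) : Q * σ = 0 := by
  obtain ⟨B, hB⟩ := exists_eq_mul_conjTranspose h
  have : Q * B = 0 := by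
    rw [← Matrix.self_mul_conjTranspose_eq_zero, Matrix.conjTranspose_mul, Matrix.mul_assoc,
      ← Matrix.mul_assoc B, ← hB, ← Matrix.mul_assoc, hQ]
  rw [hB, ← Matrix.mul_assoc, this, Matrix.zero_mul]

/-- A matrix that annihilates a sum of positive semidefinite matrices annihilates each of them. -/
lemma mul_eq_zero_of_mul_sum {ι : Type} {s : Finset ι} {σ : ι → Matrix κ κ ℂ}
    (h : ∀ j ∈ s, (σ j).PosSemidef) {Q : Matrix μ κ ℂ} (hQ : Q * ∑ j ∈ s, σ j = 0) :
    ∀ j ∈ s, Q * σ j = 0 := by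
  intro j hj
  have hp : ∀ j ∈ s, (Q * σ j * Qᴴ).PosSemidef := fun j hj => (h j hj).mul_mul_conjTranspose_same Q
  -- Nonnegative traces with sum zero all vanish.
  have h0 : ∑ j ∈ s, (Q * σ j * Qᴴ).trace = 0 := by
    rw [← Matrix.trace_sum, ← Matrix.sum_mul, ← Matrix.mul_sum, hQ]; simp
  rw [Finset.sum_eq_zero_iff_of_nonneg fun j hj => (hp j hj).trace_nonneg] at h0
  exact mul_eq_zero_of_mul_mul_conjTranspose (h j hj) ((hp j hj).trace_eq_zero_iff.1 (h0 j hj))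

/-! ### Isospectral matrices -/

/-- `ρ` and `σ` are intertwined by a partial isometry on their supports. -/
def Isospectral (ρ : Matrix κ κ ℂ) (σ : Matrix μ μ ℂ) : Prop :=
  ∃ U : Matrix κ μ ℂ, Uᴴ * U * σ = σ ∧ U * σ * Uᴴ = ρ

lemma Isospectral.symm {ρ : Matrix κ κ ℂ} {σ : Matrix μ μ ℂ} (hσ : σ.IsHermitian)
    (h : Isospectral ρ σ) : Isospectral σ ρ := by
  obtain ⟨U, hU, rfl⟩ := h
  refine ⟨Uᴴ, ?_, ?_⟩
  · rw [Matrix.conjTranspose_conjTranspose]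
    calc U * Uᴴ * (U * σ * Uᴴ) = U * (Uᴴ * U * σ) * Uᴴ := by simp only [Matrix.mul_assoc]
      _ = _ := by rw [hU]
  · have h2 : σ * (Uᴴ * U) = σ := by
      have := congrArg Matrix.conjTranspose hU
      simpa [Matrix.conjTranspose_mul, hσ.eq, Matrix.mul_assoc] using this
    calc Uᴴ * (U * σ * Uᴴ) * Uᴴᴴ = Uᴴ * U * σ * (Uᴴ * U) := by
          simp only [Matrix.mul_assoc, Matrix.conjTranspose_conjTranspose]
      _ = σ := by rw [hU, h2]

lemma Isospectral.real_smul {ρ : Matrix κ κ ℂ} {σ : Matrix μ μ ℂ} (h : Isospectral ρ σ) (c : ℝ) :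
    Isospectral (c • ρ) (c • σ) := by
  obtain ⟨U, hU, rfl⟩ := h
  exact ⟨U, by rw [Matrix.mul_smul, hU], by rw [Matrix.mul_smul, Matrix.smul_mul]⟩

lemma Isospectral.trace_eq {ρ : Matrix κ κ ℂ} {σ : Matrix μ μ ℂ} (h : Isospectral ρ σ) :
    ρ.trace = σ.trace := by
  obtain ⟨U, hU, rfl⟩ := h
  rw [Matrix.trace_mul_comm, ← Matrix.mul_assoc, hU]

lemma Isospectral.posSemidef {ρ : Matrix κ κ ℂ} {σ : Matrix μ μ ℂ} (h : Isospectral ρ σ)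
    (hσ : σ.PosSemidef) : ρ.PosSemidef := by
  obtain ⟨U, hU, rfl⟩ := h
  exact hσ.mul_mul_conjTranspose_same U

lemma Isospectral.isState {ρ : Matrix κ κ ℂ} {σ : Matrix μ μ ℂ} (h : Isospectral ρ σ)
    (hσ : IsState σ) : IsState ρ :=
  ⟨h.posSemidef hσ.1, h.trace_eq.trans hσ.2⟩

lemma Isospectral.trans {ρ : Matrix κ κ ℂ} {σ : Matrix μ μ ℂ} {τ : Matrix ν ν ℂ}
    (hτ : τ.IsHermitian) (h : Isospectral ρ σ) (h' : Isospectral σ τ) : Isospectral ρ τ := by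
  obtain ⟨V, hV, rfl⟩ := h
  obtain ⟨U, hU, rfl⟩ := h'
  have h2 : τ * (Uᴴ * U) = τ := by
    have := congrArg Matrix.conjTranspose hU
    simpa [Matrix.conjTranspose_mul, hτ.eq, Matrix.mul_assoc] using this
  -- `V` is isometric on the range of `U τ U†`; multiplying by `U` on the right and absorbing `U† U`
  -- into `τ` removes the factor `U†`.
  have h3 : Vᴴ * V * (U * τ) = U * τ := by
    have := congrArg (· * U) hV
    simp only [Matrix.mul_assoc] at this h2 ⊢
    rwa [h2] at this
  refine ⟨V * U, ?_, ?_⟩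
  · calc (V * U)ᴴ * (V * U) * τ = Uᴴ * (Vᴴ * V * (U * τ)) := by
          simp only [Matrix.conjTranspose_mul, Matrix.mul_assoc]
      _ = τ := by rw [h3, ← Matrix.mul_assoc, hU]
  · simp only [Matrix.conjTranspose_mul, Matrix.mul_assoc]

/-- The two marginals of a pure state have the same spectrum. -/
lemma isospectral_mul_conjTranspose (A : Matrix κ μ ℂ) : Isospectral (A * Aᴴ) (Aᴴ * A) := by
  have hH : (Aᴴ * A).PosSemidef := Matrix.posSemidef_conjTranspose_mul_self A
  obtain ⟨r, l, E, hE, hs', hpos⟩ : ∃ (r : ℕ) (l : Fin r → ℝ) (E : Matrix μ (Fin r) ℂ),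
      Eᴴ * E = 1 ∧ Aᴴ * A = E * diagonal (fun i => (l i : ℂ)) * Eᴴ ∧ ∀ i, 0 < l i := by
    obtain ⟨E, hE, hs⟩ := exists_spectral hH
    exact ⟨_, fun i => eig (Aᴴ * A) i, E, hE, hs, fun i => (eig_pos_iff hH i).1 i.2⟩
  set D : Matrix (Fin r) (Fin r) ℂ := diagonal fun i => (l i : ℂ) with hD
  set R : Matrix (Fin r) (Fin r) ℂ := diagonal fun i => ((Real.sqrt (l i))⁻¹ : ℂ) with hR
  have hRh : Rᴴ = R := by
    rw [hR, Matrix.diagonal_conjTranspose]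
    congr 1; ext i; simp
  have hsq : ∀ i, (Real.sqrt (l i) : ℂ) * Real.sqrt (l i) = l i := fun i => by
    rw [← Complex.ofReal_mul, Real.mul_self_sqrt (hpos i).le]
  have hs0 : ∀ i, (Real.sqrt (l i) : ℂ) ≠ 0 := fun i => by
    exact_mod_cast (Real.sqrt_pos.2 (hpos i)).ne'
  have hRDR : R * D * R = 1 := by
    rw [hR, hD, Matrix.diagonal_mul_diagonal, Matrix.diagonal_mul_diagonal, ← Matrix.diagonal_one]
    congr 1; ext i
    rw [← hsq i]; field_simp [hs0 i]
  have hEDE : Eᴴ * (Aᴴ * A) * E = D := by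
    rw [hs']
    calc Eᴴ * (E * D * Eᴴ) * E = (Eᴴ * E) * D * (Eᴴ * E) := by simp only [Matrix.mul_assoc]
      _ = D := by rw [hE]; simp
  -- `E E†` projects onto the support of `A† A`, and `A† A` and `A` have the same kernel.
  have hA : A * (E * Eᴴ) = A := by
    have : Aᴴ * A * (1 - E * Eᴴ) = 0 := by
      rw [hs', Matrix.mul_sub, Matrix.mul_one, sub_eq_zero]
      calc E * D * Eᴴ = E * D * (Eᴴ * E) * Eᴴ := by rw [hE, Matrix.mul_one]
        _ = _ := by simp only [Matrix.mul_assoc]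
    rw [Matrix.conjTranspose_mul_self_mul_eq_zero, Matrix.mul_sub, Matrix.mul_one, sub_eq_zero]
      at this
    exact this.symm
  -- With `R = D^{-1/2}` this is `A (A† A)^{-1/2}` on the support: the partial isometry of the polar
  -- decomposition.
  refine ⟨A * E * R * Eᴴ, ?_, ?_⟩
  · calc (A * E * R * Eᴴ)ᴴ * (A * E * R * Eᴴ) * (Aᴴ * A)
        = E * (R * (Eᴴ * (Aᴴ * A) * E) * R) * Eᴴ * (Aᴴ * A) := by
          simp only [Matrix.conjTranspose_mul, Matrix.conjTranspose_conjTranspose, hRh,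
            Matrix.mul_assoc]
      _ = (A * (E * Eᴴ))ᴴ * A := by
          rw [hEDE, hRDR]
          simp only [Matrix.conjTranspose_mul, Matrix.conjTranspose_conjTranspose, Matrix.mul_assoc,
            Matrix.one_mul]
      _ = Aᴴ * A := by rw [hA]
  · calc A * E * R * Eᴴ * (Aᴴ * A) * (A * E * R * Eᴴ)ᴴ
        = A * E * (R * (Eᴴ * (Aᴴ * A) * E) * R) * (A * E)ᴴ := by
          simp only [Matrix.conjTranspose_mul, Matrix.conjTranspose_conjTranspose, hRh,
            Matrix.mul_assoc]
      _ = (A * (E * Eᴴ)) * Aᴴ := by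
          rw [hEDE, hRDR]
          simp only [Matrix.conjTranspose_mul, Matrix.mul_assoc, Matrix.one_mul]
      _ = A * Aᴴ := by rw [hA]

end Spectrum

/-! ### The function `G` as a supremum over partial isometries -/

section entG

variable {κ μ : Type} [Fintype κ] [Fintype μ] [DecidableEq κ] [DecidableEq μ]
variable {R : BipartiteMeasure} {α β : Type} [Fintype α] [DecidableEq α] [Fintype β]
  [DecidableEq β]

set_option linter.unusedSectionVars false

lemma mul_diagonal_mul_conjTranspose {r : ℕ} (B : Matrix κ (Fin r) ℂ) (l : Fin r → ℝ) :
    B * diagonal (fun i => (l i : ℂ)) * Bᴴ =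
      ∑ i, l i • ketbra (WithLp.toLp 2 fun x => B x i) := by
  ext x y
  rw [Matrix.mul_apply, Matrix.sum_apply]
  refine Finset.sum_congr rfl fun i _ => ?_
  simp [Matrix.mul_diagonal, ketbra]
  ring

lemma orthonormal_columns_iff {r : ℕ} (B : Matrix κ (Fin r) ℂ) :
    Orthonormal ℂ (fun i => (WithLp.toLp 2 fun x => B x i : EuclideanSpace ℂ κ)) ↔
      Bᴴ * B = 1 := by
  rw [orthonormal_iff_ite, ← Matrix.ext_iff]
  refine forall_congr' fun i => forall_congr' fun j => ?_
  rw [Matrix.one_apply, Matrix.mul_apply, PiLp.inner_apply]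
  simp [mul_comm]

lemma sum_eig {M : Type} [AddCommGroup M] [Module ℝ M] {ρ : Matrix κ κ ℂ} (h : ρ.PosSemidef)
    {n : ℕ} (hn : ρ.rank ≤ n) (f : Fin n → M) :
    ∑ i : Fin n, eig ρ i • f i = ∑ i : Fin ρ.rank, eig ρ i • f (Fin.castLE hn i) := by
  symm
  apply Fintype.sum_of_injective _ (Fin.castLE_injective hn)
  · intro i hi
    rw [(eig_pos_iff h i).2, zero_smul]
    by_contra hlt
    exact hi ⟨⟨i, not_le.1 hlt⟩, rfl⟩
  · intro i; rfl

/-- Only the first `ρ.rank` basis vectors count, and choosing them amounts to choosing the images of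
the eigenvectors under `V`. If the rank exceeds the dimension there is no `V`, and `sSup ∅ = 0`
reproduces the default value, so later arguments need no case distinction. -/
lemma entG_eq {ρ : Matrix κ κ ℂ} (h : ρ.PosSemidef) :
    entG R α β ρ = sSup {x | ∃ V : Matrix (α × β) κ ℂ,
      Vᴴ * V * ρ = ρ ∧ x = R α β (V * ρ * Vᴴ)} := by
  obtain ⟨E, hE, hs⟩ := exists_spectral h
  set D := diagonal (fun i : Fin ρ.rank => (eig ρ i : ℂ)) with hD
  have hcancel : E * D * Eᴴ * E = E * D := by rw [Matrix.mul_assoc, hE, Matrix.mul_one]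
  unfold entG
  split_ifs with hr
  · congr 1
    ext x
    constructor
    · rintro ⟨b, rfl⟩
      let B : Matrix (α × β) (Fin ρ.rank) ℂ := Matrix.of fun x i => b (Fin.castLE hr i) x
      have hB : Bᴴ * B = 1 := by
        rw [← orthonormal_columns_iff]
        exact b.orthonormal.comp _ (Fin.castLE_injective hr)
      have e1 : (B * Eᴴ)ᴴ * (B * Eᴴ) = E * Eᴴ := by
        rw [Matrix.conjTranspose_mul, Matrix.conjTranspose_conjTranspose, Matrix.mul_assoc,
          ← Matrix.mul_assoc Bᴴ, hB, Matrix.one_mul]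
      have e2 : E * Eᴴ * (E * D * Eᴴ) = E * D * Eᴴ := by
        calc E * Eᴴ * (E * D * Eᴴ) = E * (Eᴴ * E) * D * Eᴴ := by simp only [Matrix.mul_assoc]
          _ = _ := by rw [hE, Matrix.mul_one]
      have e3 : B * Eᴴ * (E * D * Eᴴ) * (B * Eᴴ)ᴴ = B * D * Bᴴ := by
        calc B * Eᴴ * (E * D * Eᴴ) * (B * Eᴴ)ᴴ = B * (Eᴴ * E) * D * (Eᴴ * E) * Bᴴ := by
              simp only [Matrix.conjTranspose_mul, Matrix.conjTranspose_conjTranspose,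
                Matrix.mul_assoc]
          _ = _ := by rw [hE, Matrix.mul_one, Matrix.mul_one]
      -- This `V` sends the `i`-th eigenvector to the `i`-th basis vector.
      refine ⟨B * Eᴴ, ?_, ?_⟩
      · rw [e1]; exact (congrArg (E * Eᴴ * ·) hs).trans (e2.trans hs.symm)
      · congr 1
        rw [sum_eig h hr fun i => ketbra (b i)]
        refine Eq.trans ?_ ((congrArg (fun X => B * Eᴴ * X * (B * Eᴴ)ᴴ) hs).trans e3).symm
        rw [hD, mul_diagonal_mul_conjTranspose]
        rfl
    · rintro ⟨V, hV, rfl⟩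
      -- The eigenvalues in `D` are positive and can be cancelled column by column.
      have hVE : Vᴴ * V * E = E := by
        have h1 : Vᴴ * V * (E * D) = E * D := by
          rw [← hcancel, ← hs, ← Matrix.mul_assoc, hV]
        ext x i
        have h2 := congrFun (congrFun h1 x) i
        rw [← Matrix.mul_assoc, hD, Matrix.mul_diagonal, Matrix.mul_diagonal] at h2
        refine mul_right_cancel₀ ?_ h2
        exact_mod_cast ((eig_pos_iff h i).1 i.2).ne'
      have hB : (V * E)ᴴ * (V * E) = 1 := by
        rw [Matrix.conjTranspose_mul, Matrix.mul_assoc, ← Matrix.mul_assoc Vᴴ, hVE, hE]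
      -- The zeros beyond the rank are placeholders: only the orthonormal columns of `V E` are
      -- extended to a basis.
      let v : Fin (Fintype.card (α × β)) → EuclideanSpace ℂ (α × β) := fun i =>
        if hi : (i : ℕ) < ρ.rank then WithLp.toLp 2 fun x => (V * E) x ⟨i, hi⟩ else 0
      have hv : Orthonormal ℂ
          (Set.domRestrict {i : Fin (Fintype.card (α × β)) | (i : ℕ) < ρ.rank} v) := by
        have := ((orthonormal_columns_iff _).2 hB).comp
          (fun i : {i : Fin (Fintype.card (α × β)) | (i : ℕ) < ρ.rank} => (⟨i.1, i.2⟩ : Fin ρ.rank))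
          (fun i j hij => Subtype.ext (Fin.ext (by simpa using hij)))
        convert this using 1
        ext1 i
        simp only [Set.domRestrict_apply, v]
        exact dif_pos i.2
      obtain ⟨b, hb⟩ := hv.exists_orthonormalBasis_extension_of_card_eq (by simp)
      refine ⟨b, ?_⟩
      congr 1
      rw [sum_eig h hr fun i => ketbra (b i)]
      have e3 : V * (E * D * Eᴴ) * Vᴴ = (V * E) * D * (V * E)ᴴ := by
        simp only [Matrix.conjTranspose_mul, Matrix.mul_assoc]
      refine ((congrArg (fun X => V * X * Vᴴ) hs).trans e3).trans ?_
      rw [hD, mul_diagonal_mul_conjTranspose]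
      refine Finset.sum_congr rfl fun i _ => ?_
      rw [hb (Fin.castLE hr i) i.2]
      simp [v]
  · symm
    convert Real.sSup_empty
    rw [Set.eq_empty_iff_forall_notMem]
    rintro x ⟨V, hV, -⟩
    apply hr
    rw [← hV, Matrix.mul_assoc]
    exact (Matrix.rank_mul_le_left _ _).trans (Matrix.rank_le_card_width _)

lemma isState_of_isometry {ρ : Matrix κ κ ℂ} (h : IsState ρ) {V : Matrix μ κ ℂ}
    (hV : Vᴴ * V * ρ = ρ) : IsState (V * ρ * Vᴴ) :=
  Isospectral.isState ⟨V, hV, rfl⟩ h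

variable (α β) in
/-- The states of `α : β` have measure at most `Rsup`. -/
def HasSup (R : BipartiteMeasure) : Prop :=
  (∀ ρ : Matrix (α × β) (α × β) ℂ, IsState ρ → 0 ≤ R α β ρ) ∧
    ∀ ρ : Matrix (α × β) (α × β) ℂ, IsState ρ → R α β ρ ≤ Rsup R α β

lemma entG_le {ρ : Matrix κ κ ℂ} (h : ρ.PosSemidef) {c : ℝ} (hc : 0 ≤ c)
    (hV : ∀ V : Matrix (α × β) κ ℂ, Vᴴ * V * ρ = ρ → R α β (V * ρ * Vᴴ) ≤ c) :
    entG R α β ρ ≤ c := by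
  rw [entG_eq h]
  refine Real.sSup_le ?_ hc
  rintro x ⟨V, h1, rfl⟩
  exact hV V h1

lemma le_entG (hR : HasSup α β R) {ρ : Matrix κ κ ℂ} (h : IsState ρ) {V : Matrix (α × β) κ ℂ}
    (hV : Vᴴ * V * ρ = ρ) : R α β (V * ρ * Vᴴ) ≤ entG R α β ρ := by
  rw [entG_eq h.1]
  refine le_csSup ⟨Rsup R α β, ?_⟩ ⟨V, hV, rfl⟩
  rintro x ⟨W, hW, rfl⟩
  exact hR.2 _ (isState_of_isometry h hW)

lemma entG_nonneg (hR : HasSup α β R) {ρ : Matrix κ κ ℂ} (h : IsState ρ) :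
    0 ≤ entG R α β ρ := by
  rw [entG_eq h.1]
  refine Real.sSup_nonneg ?_
  rintro x ⟨W, hW, rfl⟩
  exact hR.1 _ (isState_of_isometry h hW)

lemma Rsup_nonneg (hR : ∀ ρ : Matrix (α × β) (α × β) ℂ, IsState ρ → 0 ≤ R α β ρ) :
    0 ≤ Rsup R α β :=
  Real.sSup_nonneg (by rintro x ⟨ρ, hρ, rfl⟩; exact hR ρ hρ)

lemma entS_nonneg (hR : HasSup α β R) {ρ : Matrix κ κ ℂ} (h : IsState ρ) :
    0 ≤ entS R α β ρ :=
  sub_nonneg.2 (entG_le h.1 (Rsup_nonneg hR.1) fun _ hV => hR.2 _ (isState_of_isometry h hV))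

/-- Each supremum runs over the matrices on `α × β` isospectral to the argument, and isospectrality
is symmetric and transitive. -/
lemma entG_congr {ρ : Matrix κ κ ℂ} {σ : Matrix μ μ ℂ} (hσ : σ.PosSemidef)
    (h : Isospectral ρ σ) : entG R α β ρ = entG R α β σ := by
  have hρ := h.posSemidef hσ
  rw [entG_eq hρ, entG_eq hσ]
  have key : ∀ (x : ℝ), (∃ V : Matrix (α × β) κ ℂ, Vᴴ * V * ρ = ρ ∧ x = R α β (V * ρ * Vᴴ)) ↔
      ∃ τ : Matrix (α × β) (α × β) ℂ, Isospectral τ ρ ∧ x = R α β τ := fun x =>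
    ⟨fun ⟨V, hV, hx⟩ => ⟨_, ⟨V, hV, rfl⟩, hx⟩, fun ⟨_, ⟨V, hV, hτ⟩, hx⟩ => ⟨V, hV, by rw [hτ, hx]⟩⟩
  have key' : ∀ (x : ℝ), (∃ V : Matrix (α × β) μ ℂ, Vᴴ * V * σ = σ ∧ x = R α β (V * σ * Vᴴ)) ↔
      ∃ τ : Matrix (α × β) (α × β) ℂ, Isospectral τ σ ∧ x = R α β τ := fun x =>
    ⟨fun ⟨V, hV, hx⟩ => ⟨_, ⟨V, hV, rfl⟩, hx⟩, fun ⟨_, ⟨V, hV, hτ⟩, hx⟩ => ⟨V, hV, by rw [hτ, hx]⟩⟩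
  congr 1
  ext x
  simp only [Set.mem_ofPred_eq, key, key']
  exact ⟨fun ⟨τ, hτ, hx⟩ => ⟨τ, hτ.trans hσ.1 h, hx⟩,
    fun ⟨τ, hτ, hx⟩ => ⟨τ, hτ.trans hρ.1 (h.symm hσ.1), hx⟩⟩

/-- Any competitor `V` for the mixture is isometric on each component, so it yields a mixture of
competitors, to which convexity of `R` applies. Hence `entS` is concave. -/
lemma entG_sum_le (hR : HasSup α β R)
    (hconv : ConvexOn ℝ {ρ : Matrix (α × β) (α × β) ℂ | IsState ρ} (R α β))
    {ι : Type} {s : Finset ι} {w : ι → ℝ} {ρ : ι → Matrix κ κ ℂ} (hw : ∀ j ∈ s, 0 < w j)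
    (hw1 : ∑ j ∈ s, w j = 1) (hρ : ∀ j ∈ s, IsState (ρ j)) :
    entG R α β (∑ j ∈ s, w j • ρ j) ≤ ∑ j ∈ s, w j * entG R α β (ρ j) := by
  have hp : ∀ j ∈ s, (w j • ρ j).PosSemidef := fun j hj =>
    posSemidef_real_smul (hρ j hj).1 (hw j hj).le
  refine entG_le (posSemidef_sum s hp)
    (Finset.sum_nonneg fun j hj => mul_nonneg (hw j hj).le (entG_nonneg hR (hρ j hj))) fun V hV => ?_
  have hVj : ∀ j ∈ s, Vᴴ * V * ρ j = ρ j := fun j hj => by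
    -- Being isometric on the support means that `1 - V† V` annihilates the mixture, hence every
    -- component.
    have h0 : (1 - Vᴴ * V) * ∑ j ∈ s, w j • ρ j = 0 := by
      rw [Matrix.sub_mul, hV, Matrix.one_mul, sub_self]
    have := mul_eq_zero_of_mul_sum hp h0 j hj
    rw [Matrix.mul_smul] at this
    have := (smul_eq_zero.1 this).resolve_left (hw j hj).ne'
    rw [Matrix.sub_mul, Matrix.one_mul, sub_eq_zero] at this
    exact this.symm
  have : V * (∑ j ∈ s, w j • ρ j) * Vᴴ = ∑ j ∈ s, w j • (V * ρ j * Vᴴ) := by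
    simp only [Matrix.mul_sum, Matrix.sum_mul, Matrix.mul_smul, Matrix.smul_mul]
  rw [this]
  refine (hconv.map_sum_le (fun j hj => (hw j hj).le) hw1
    fun j hj => isState_of_isometry (hρ j hj) (hVj j hj)).trans ?_
  exact Finset.sum_le_sum fun j hj =>
    mul_le_mul_of_nonneg_left (le_entG hR (hρ j hj) (hVj j hj)) (hw j hj).le

/-! ### The homogeneous extension of the entropy -/

variable (R α β) in
/-- The entropy `S`, extended homogeneously to the positive semidefinite matrices. -/
def homS (σ : Matrix κ κ ℂ) : ℝ :=
  σ.trace.re * entS R α β (σ.trace.re⁻¹ • σ)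

lemma homS_of_isState {σ : Matrix κ κ ℂ} (h : IsState σ) : homS R α β σ = entS R α β σ := by
  rw [homS, h.trace_re]; simp

lemma homS_smul (c : ℝ) (σ : Matrix κ κ ℂ) : homS R α β (c • σ) = c * homS R α β σ := by
  rcases eq_or_ne c 0 with rfl | hc
  · simp [homS]
  · have : (c * σ.trace.re)⁻¹ * c = σ.trace.re⁻¹ := by
      rw [mul_inv, mul_right_comm, inv_mul_cancel₀ hc, one_mul]
    rw [homS, homS, re_trace_real_smul, smul_smul, this, mul_assoc]

lemma homS_nonneg (hR : HasSup α β R) {σ : Matrix κ κ ℂ} (h : σ.PosSemidef) :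
    0 ≤ homS R α β σ := by
  rcases eq_or_ne σ.trace.re 0 with h0 | h0
  · simp [homS, h0]
  · exact mul_nonneg (trace_re_nonneg h) (entS_nonneg hR (isState_inv_smul h h0))

lemma homS_congr {ρ : Matrix κ κ ℂ} {σ : Matrix μ μ ℂ} (hσ : σ.PosSemidef)
    (h : Isospectral ρ σ) : homS R α β ρ = homS R α β σ := by
  rw [homS, homS, h.trace_eq, entS, entS, entG_congr
    (posSemidef_real_smul hσ (inv_nonneg.2 (trace_re_nonneg hσ))) (h.real_smul _)]

/-- For the vector with coefficient matrix `A`, these are its first marginal and the transpose of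
its second. -/
lemma homS_mul_conjTranspose (A : Matrix κ μ ℂ) :
    homS R α β (A * Aᴴ) = homS R α β (Aᴴ * A) :=
  homS_congr (Matrix.posSemidef_conjTranspose_mul_self A) (isospectral_mul_conjTranspose A)

/-- Concavity of `S` in homogeneous form: superadditivity, which needs no normalization of
measurement outcomes. -/
lemma sum_homS_le (hR : HasSup α β R)
    (hconv : ConvexOn ℝ {ρ : Matrix (α × β) (α × β) ℂ | IsState ρ} (R α β))
    {ι : Type} [Fintype ι] {σ : ι → Matrix κ κ ℂ} (hσ : ∀ j, (σ j).PosSemidef) :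
    ∑ j, homS R α β (σ j) ≤ homS R α β (∑ j, σ j) := by
  classical
  have hp := posSemidef_sum Finset.univ fun j _ => hσ j
  have htr : (∑ j, σ j).trace.re = ∑ j, (σ j).trace.re := by
    rw [Matrix.trace_sum, Complex.re_sum]
  rcases eq_or_ne (∑ j, σ j).trace.re 0 with h0 | h0
  · have hz : ∀ j, (σ j).trace.re = 0 := fun j =>
      (Finset.sum_eq_zero_iff_of_nonneg fun j _ => trace_re_nonneg (hσ j)).1 (htr ▸ h0) j
        (Finset.mem_univ _)
    simp only [homS, h0, hz, zero_mul, Finset.sum_const_zero, le_refl]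
  set t := (∑ j, σ j).trace.re with ht
  have htpos : 0 < t := (trace_re_nonneg hp).lt_of_ne' h0
  -- Terms of trace zero are zero matrices and cannot be normalized. The others enter as states with
  -- weights `tr σ_j / t`.
  let s : Finset ι := Finset.univ.filter fun j => (σ j).trace.re ≠ 0
  have hs : ∀ j ∈ s, (σ j).trace.re ≠ 0 := fun j hj => (Finset.mem_filter.1 hj).2
  have hs' : ∀ j ∉ s, (σ j).trace.re = 0 := fun j hj => by simpa [s] using hj
  have h1 : ∑ j ∈ s, (σ j).trace.re = t := by
    rw [htr]
    exact Finset.sum_subset (Finset.subset_univ _) fun j _ hj => hs' j hj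
  have h2 : ∑ j ∈ s, (t⁻¹ * (σ j).trace.re) • ((σ j).trace.re⁻¹ • σ j) = t⁻¹ • ∑ j, σ j := by
    rw [← Finset.sum_subset (Finset.subset_univ s) fun j _ hj =>
      eq_zero_of_trace_re (hσ j) (hs' j hj), Finset.smul_sum]
    refine Finset.sum_congr rfl fun j hj => ?_
    rw [smul_smul, mul_assoc, mul_inv_cancel₀ (hs j hj), mul_one]
  have h3 := entG_sum_le (s := s) (w := fun j => t⁻¹ * (σ j).trace.re)
    (ρ := fun j => (σ j).trace.re⁻¹ • σ j) hR hconv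
    (fun j hj => mul_pos (inv_pos.2 htpos) ((trace_re_nonneg (hσ j)).lt_of_ne' (hs j hj)))
    (by rw [← Finset.mul_sum, h1, inv_mul_cancel₀ h0])
    (fun j hj => isState_inv_smul (hσ j) (hs j hj))
  rw [h2] at h3
  have h4 : ∑ j, homS R α β (σ j) = ∑ j ∈ s, homS R α β (σ j) := by
    symm
    exact Finset.sum_subset (Finset.subset_univ _) fun j _ hj => by simp [homS, hs' j hj]
  have h5 : ∑ j ∈ s, homS R α β (σ j) =
      t * Rsup R α β - ∑ j ∈ s, (σ j).trace.re * entG R α β ((σ j).trace.re⁻¹ • σ j) := by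
    simp only [homS, entS, mul_sub, Finset.sum_sub_distrib]
    rw [← Finset.sum_mul, h1]
  have h6 : t * ∑ j ∈ s, t⁻¹ * (σ j).trace.re * entG R α β ((σ j).trace.re⁻¹ • σ j) =
      ∑ j ∈ s, (σ j).trace.re * entG R α β ((σ j).trace.re⁻¹ • σ j) := by
    rw [Finset.mul_sum]
    refine Finset.sum_congr rfl fun j _ => ?_
    field_simp
  have h7 := mul_le_mul_of_nonneg_left h3 htpos.le
  rw [h4, h5, homS, entS, ← ht, mul_sub]
  linarith

end entG

/-! ### Bipartite vectors as matrices -/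

section pvec

variable {κ μ κ' μ' : Type} [Fintype κ] [Fintype μ] [Fintype κ'] [Fintype μ']

set_option linter.unusedSectionVars false

/-- The bipartite vector with the coefficient matrix `A`. -/
def pvec (A : Matrix κ μ ℂ) : EuclideanSpace ℂ (κ × μ) :=
  WithLp.toLp 2 fun x => A x.1 x.2

lemma eq_pvec (ψ : EuclideanSpace ℂ (κ × μ)) : ψ = pvec (Matrix.of fun x y => ψ (x, y)) := rfl

/-- Local operations become left and right multiplications of the coefficient matrix. -/
lemma kronecker_mulVec_pvec (M : Matrix κ' κ ℂ) (N : Matrix μ' μ ℂ) (A : Matrix κ μ ℂ) :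
    WithLp.toLp 2 ((M ⊗ₖ N) *ᵥ (pvec A).ofLp) = pvec (M * A * Nᵀ) := by
  ext ⟨x, y⟩
  simp only [pvec, Matrix.mulVec, dotProduct, Fintype.sum_prod_type, Matrix.kroneckerMap_apply,
    Matrix.mul_apply, Matrix.transpose_apply, Finset.sum_mul]
  rw [Finset.sum_comm]
  refine Finset.sum_congr rfl fun i _ => Finset.sum_congr rfl fun j _ => ?_
  ring

lemma kronecker_conj_ketbra_pvec (M : Matrix κ' κ ℂ) (N : Matrix μ' μ ℂ) (A : Matrix κ μ ℂ) :
    (M ⊗ₖ N) * ketbra (pvec A) * (M ⊗ₖ N)ᴴ = ketbra (pvec (M * A * Nᵀ)) := by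
  rw [← ketbra_mulVec, kronecker_mulVec_pvec]

lemma ptrace_ketbra_pvec (A : Matrix κ μ ℂ) : ptrace (ketbra (pvec A)) = A * Aᴴ := rfl

lemma trace_ptrace (ρ : Matrix (κ × μ) (κ × μ) ℂ) : (ptrace ρ).trace = ρ.trace := by
  simp [ptrace, Matrix.trace, Fintype.sum_prod_type]

lemma norm_pvec_sq (A : Matrix κ μ ℂ) : ‖pvec A‖ ^ 2 = (A * Aᴴ).trace.re := by
  rw [← ptrace_ketbra_pvec, trace_ptrace, trace_re_ketbra]

lemma pvec_real_smul (c : ℝ) (A : Matrix κ μ ℂ) : pvec (c • A) = c • pvec A := rfl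

lemma ptrace_posSemidef {ρ : Matrix (κ × μ) (κ × μ) ℂ} (h : ρ.PosSemidef) :
    (ptrace ρ).PosSemidef := by
  have : ptrace ρ = ∑ z, ρ.submatrix (fun x => (x, z)) (fun x => (x, z)) := by
    ext x y; simp [ptrace, Matrix.sum_apply]
  rw [this]
  exact posSemidef_sum _ fun z _ => h.submatrix _

lemma IsState.ptrace {ρ : Matrix (κ × μ) (κ × μ) ℂ} (h : IsState ρ) : IsState (ptrace ρ) :=
  ⟨ptrace_posSemidef h.1, (trace_ptrace ρ).trans h.2⟩

end pvec

/-- Every state is a mixture of pure states. -/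
lemma exists_ensemble {κ : Type} [Fintype κ] [DecidableEq κ] {ρ : Matrix κ κ ℂ} (h : IsState ρ) :
    ∃ (m : ℕ) (P : Fin m → ℝ) (Ψ : Fin m → EuclideanSpace ℂ κ),
      (∀ k, 0 ≤ P k) ∧ (∀ k, ‖Ψ k‖ = 1) ∧ ∑ k, P k = 1 ∧ ∑ k, P k • ketbra (Ψ k) = ρ := by
  obtain ⟨E, hE, hs⟩ := exists_spectral h.1
  have ho := (orthonormal_columns_iff E).2 hE
  rw [mul_diagonal_mul_conjTranspose] at hs
  refine ⟨_, fun i => eig ρ i, _, fun k => ((eig_pos_iff h.1 k).1 k.2).le, ho.1, ?_, hs.symm⟩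
  have h1 := h.trace_re
  have h2 : ρ.trace.re = ∑ i : Fin ρ.rank, eig ρ i := by
    refine (congrArg (fun X => (Matrix.trace X).re) hs).trans ?_
    rw [Matrix.trace_sum, Complex.re_sum]
    refine Finset.sum_congr rfl fun i _ => ?_
    rw [re_trace_real_smul, trace_re_ketbra, ho.1 i]; simp
  rw [← h2, h1]

/-! ### LOCC transformations with one measurement and a correction -/

section LOCC

variable {α β α' β' : Type} [Fintype α] [DecidableEq α] [Fintype β] [DecidableEq β]
  [Fintype α'] [DecidableEq α'] [Fintype β'] [DecidableEq β']

/-- The correction `N j` is a measurement with one outcome; the nested sigma type lists the leaves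
of the protocol tree. -/
lemma isLOCC_alice_bob {r : Type} [Fintype r] {M : r → Matrix α' α ℂ} {N : r → Matrix β' β ℂ}
    (hM : ∑ j, (M j)ᴴ * M j = 1) (hN : ∀ j, (N j)ᴴ * N j = 1) :
    IsLOCC (q := Σ _ : r, Σ _ : Unit, Unit) (outA := fun _ => α') (outB := fun _ => β')
      (fun x => M x.1 ⊗ₖ N x.1) := by
  have h := IsLOCC.alice (β := β) M hM _ fun j =>
    IsLOCC.bob (r := Unit) (α := α') (fun _ => N j) (by simp [hN]) _ fun _ =>
      IsLOCC.nothing α' β'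
  have e : (fun x : (Σ _ : r, Σ _ : Unit, Unit) => M x.1 ⊗ₖ N x.1) = fun x =>
      (1 : Matrix (α' × β') (α' × β') ℂ) * ((1 : Matrix α' α' ℂ) ⊗ₖ N x.1) *
        (M x.1 ⊗ₖ (1 : Matrix β β ℂ)) := by
    funext x
    rw [Matrix.one_mul, ← Matrix.mul_kronecker_mul, Matrix.one_mul, Matrix.mul_one]
  rw [e]
  exact h

lemma isLOCC_bob_alice {r : Type} [Fintype r] {M : r → Matrix α' α ℂ} {N : r → Matrix β' β ℂ}
    (hM : ∀ j, (M j)ᴴ * M j = 1) (hN : ∑ j, (N j)ᴴ * N j = 1) :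
    IsLOCC (q := Σ _ : r, Σ _ : Unit, Unit) (outA := fun _ => α') (outB := fun _ => β')
      (fun x => M x.1 ⊗ₖ N x.1) := by
  have h := IsLOCC.bob (α := α) N hN _ fun j =>
    IsLOCC.alice (r := Unit) (β := β') (fun _ => M j) (by simp [hM]) _ fun _ =>
      IsLOCC.nothing α' β'
  have e : (fun x : (Σ _ : r, Σ _ : Unit, Unit) => M x.1 ⊗ₖ N x.1) = fun x =>
      (1 : Matrix (α' × β') (α' × β') ℂ) * (M x.1 ⊗ₖ (1 : Matrix β' β' ℂ)) *
        ((1 : Matrix α α ℂ) ⊗ₖ N x.1) := by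
    funext x
    rw [Matrix.one_mul, ← Matrix.mul_kronecker_mul, Matrix.one_mul, Matrix.mul_one]
  rw [e]
  exact h

/-- A monotone does not increase if an LOCC measurement leads to the same state at all outcomes. -/
lemma IsEntanglementMonotone.le_of_locc {E : BipartiteMeasure} (hE : IsEntanglementMonotone E)
    {q : Type} [Fintype q] {K : q → Matrix (α' × β') (α × β) ℂ}
    (hK : IsLOCC (outA := fun _ => α') (outB := fun _ => β') K)
    {ρ : Matrix (α × β) (α × β) ℂ} {σ : Matrix (α' × β') (α' × β') ℂ} (hρ : IsState ρ)
    (hσ : IsState σ) {p : q → ℝ} (hp : ∑ i, p i = 1) (h : ∀ i, K i * ρ * (K i)ᴴ = p i • σ) :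
    E α' β' σ ≤ E α β ρ := by
  rcases hE.monotone with hm | hm
  · have := hm α β α' β' q K hK ρ hρ
    simpa only [h, ← Finset.sum_smul, hp, one_smul] using this
  · have := hm α β q (fun _ => α') (fun _ => β') K hK ρ hρ
    have ht : ∀ i, ((K i)ᴴ * K i * ρ).trace.re = p i := fun i => by
      rw [Matrix.mul_assoc, Matrix.trace_mul_comm, h, re_trace_real_smul, hσ.trace_re, mul_one]
    -- An outcome of probability zero is not normalized to `σ`, but its weight removes it from both
    -- sides.
    have e : ∀ i, p i * E α' β' ((p i)⁻¹ • p i • σ) = p i * E α' β' σ := fun i => by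
      rcases eq_or_ne (p i) 0 with h0 | h0
      · rw [h0, zero_mul, zero_mul]
      · rw [smul_smul, inv_mul_cancel₀ h0, one_smul]
    simpa only [ht, h, e, ← Finset.sum_mul, hp, one_mul] using this

end LOCC

/-! ### Maximally entangled states -/

section MaxEntangled

variable {α β : Type} [Fintype α] [DecidableEq α] [Fintype β] [DecidableEq β]

/-- Averaging over the cyclic shifts of an eigenbasis. -/
lemma exists_twirl [Nonempty β] {d : ℕ} (hd : Fintype.card β = d) {H : Matrix β β ℂ}
    (hH : IsState H) :
    ∃ W : Fin d → Matrix β (Fin d) ℂ, (∀ s, W s * (W s)ᴴ = 1) ∧ (∀ s, (W s)ᴴ * W s = 1) ∧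
      ∑ s, (W s)ᴴ * H * W s = 1 := by
  have : NeZero d := ⟨by rw [← hd]; exact Fintype.card_ne_zero⟩
  let e : Fin d ≃ β := (Fintype.equivFinOfCardEq hd).symm
  set U : Matrix β β ℂ := (hH.1.1.eigenvectorUnitary : Matrix β β ℂ)
  have h1 : Uᴴ * U = 1 := Matrix.mem_unitaryGroup_iff'.1 hH.1.1.eigenvectorUnitary.2
  have h2 : U * Uᴴ = 1 := Matrix.mem_unitaryGroup_iff.1 hH.1.1.eigenvectorUnitary.2
  set l := hH.1.1.eigenvalues
  have hs : H = U * diagonal (fun k => (l k : ℂ)) * Uᴴ := by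
    conv_lhs => rw [hH.1.1.spectral_theorem, Unitary.conjStarAlgAut_apply]
    rfl
  have h3 : Uᴴ * H * U = diagonal (fun k => (l k : ℂ)) := by
    rw [hs]
    calc Uᴴ * (U * diagonal (fun k => (l k : ℂ)) * Uᴴ) * U
        = (Uᴴ * U) * diagonal (fun k => (l k : ℂ)) * (Uᴴ * U) := by simp only [Matrix.mul_assoc]
      _ = _ := by rw [h1, Matrix.one_mul, Matrix.mul_one]
  have h4 : ∑ k, (l k : ℂ) = 1 := by
    have := hH.1.1.trace_eq_sum_eigenvalues
    exact this.symm.trans hH.2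
  -- The columns of `W s` are the eigenbasis shifted cyclically by `s`. In the sum over `s`, each
  -- diagonal entry collects all the eigenvalues, that is, the trace `1`.
  let f : Fin d → Fin d ≃ β := fun s => (Equiv.addLeft s).trans e
  refine ⟨fun s => U.submatrix id (f s), fun s => ?_, fun s => ?_, ?_⟩
  · rw [Matrix.conjTranspose_submatrix, Matrix.submatrix_mul_equiv, h2, Matrix.submatrix_id_id]
  · rw [Matrix.conjTranspose_submatrix, ← Matrix.submatrix_mul _ _ _ id _ Function.bijective_id,
      h1, Matrix.submatrix_one_equiv]
  · have : ∀ s, (U.submatrix id (f s))ᴴ * H * U.submatrix id (f s) =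
        diagonal fun i => (l (e (s + i)) : ℂ) := fun s => by
      have hH' : H = H.submatrix id id := (Matrix.submatrix_id_id H).symm
      rw [Matrix.conjTranspose_submatrix]
      conv_lhs => rw [hH']
      rw [← Matrix.submatrix_mul _ _ _ id _ Function.bijective_id,
        ← Matrix.submatrix_mul _ _ _ id _ Function.bijective_id, h3,
        Matrix.submatrix_diagonal_equiv]
      rfl
    simp only [this]
    ext i j
    rw [Matrix.sum_apply, Matrix.one_apply]
    by_cases hij : i = j
    · subst hij
      simp only [Matrix.diagonal_apply_eq, if_true]
      rw [← h4]
      exact Fintype.sum_equiv ((Equiv.addRight i).trans e) _ _ fun s => rfl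
    · simp [hij]

/-- A measurement of the larger party and a unitary correction of the smaller one transform a
maximally entangled vector to any other unit vector. -/
lemma exists_measurement [Nonempty β] {d : ℕ} (hd : Fintype.card β = d) {a : Matrix α (Fin d) ℂ}
    (ha : aᴴ * a = 1) {b : Matrix β (Fin d) ℂ} (hb : bᴴ * b = 1) {A : Matrix α β ℂ}
    (hA : (Aᴴ * A).trace = 1) :
    ∃ (M : Option (Fin d) → Matrix α α ℂ) (N : Option (Fin d) → Matrix β β ℂ),
      ∑ j, (M j)ᴴ * M j = 1 ∧ (∀ j, (N j)ᴴ * N j = 1) ∧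
      ∀ j, M j * (a * bᵀ) * (N j)ᵀ = (j.elim 0 fun _ => 1 : ℝ) • A := by
  obtain ⟨W, hW1, hW2, hW3⟩ :=
    exists_twirl hd (H := Aᴴ * A) ⟨Matrix.posSemidef_conjTranspose_mul_self A, hA⟩
  have hbb : b * bᴴ = 1 := (Matrix.mul_eq_one_comm_of_card_eq _ _ _ (by simp [hd])).1 hb
  have hbt : bᵀ * bᴴᵀ = 1 := by rw [← Matrix.transpose_mul, hb, Matrix.transpose_one]
  have hpp : (1 - a * aᴴ)ᴴ * (1 - a * aᴴ) = 1 - a * aᴴ := by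
    have : a * aᴴ * (a * aᴴ) = a * aᴴ := by
      rw [Matrix.mul_assoc, ← Matrix.mul_assoc aᴴ, ha, Matrix.one_mul]
    rw [Matrix.conjTranspose_sub, Matrix.conjTranspose_mul, Matrix.conjTranspose_conjTranspose,
      Matrix.conjTranspose_one, Matrix.sub_mul, Matrix.mul_sub, Matrix.mul_sub, this]
    simp
  -- By the twirl, the outcomes `s` sum to `a a†`; the outcome `none` completes the measurement and
  -- never occurs on `a bᵀ`. At outcome `s` the correction undoes `W s`, leaving `A` whatever `s`
  -- is. It is unitary because `b` is square.
  refine ⟨fun j => j.elim (1 - a * aᴴ) fun s => A * W s * aᴴ,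
    fun j => j.elim 1 fun s => (W s)ᴴᵀ * bᴴ, ?_, ?_, ?_⟩
  · rw [Fintype.sum_option]
    have : ∀ s, (A * W s * aᴴ)ᴴ * (A * W s * aᴴ) = a * ((W s)ᴴ * (Aᴴ * A) * W s) * aᴴ := fun s => by
      simp only [Matrix.conjTranspose_mul, Matrix.conjTranspose_conjTranspose, Matrix.mul_assoc]
    simp only [Option.elim, this]
    rw [← Matrix.sum_mul, ← Matrix.mul_sum, hW3, hpp, Matrix.mul_one, sub_add_cancel]
  · rintro (_ | s)
    · simp
    · have hWt : (W s)ᵀ * (W s)ᴴᵀ = 1 := by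
        rw [← Matrix.transpose_mul, hW2, Matrix.transpose_one]
      have : ((W s)ᴴᵀ)ᴴ = (W s)ᵀ := by
        ext; simp
      calc ((W s)ᴴᵀ * bᴴ)ᴴ * ((W s)ᴴᵀ * bᴴ) = b * ((W s)ᵀ * (W s)ᴴᵀ) * bᴴ := by
            simp only [Matrix.conjTranspose_mul, Matrix.conjTranspose_conjTranspose, this,
              Matrix.mul_assoc]
        _ = 1 := by rw [hWt, Matrix.mul_one, hbb]
  · rintro (_ | s)
    · simp only [Option.elim, zero_smul]
      rw [← Matrix.mul_assoc, Matrix.sub_mul, Matrix.mul_assoc a, ha]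
      simp
    · simp only [Option.elim, one_smul, Matrix.transpose_mul, Matrix.transpose_transpose]
      calc A * W s * aᴴ * (a * bᵀ) * (bᴴᵀ * (W s)ᴴ)
          = A * (W s * (aᴴ * a) * (bᵀ * bᴴᵀ) * (W s)ᴴ) := by simp only [Matrix.mul_assoc]
        _ = A := by rw [ha, hbt, Matrix.mul_one, Matrix.mul_one, hW1, Matrix.mul_one]

lemma exists_pvec_of_isMaximallyEntangled {Φ : Matrix (α × β) (α × β) ℂ}
    (h : IsMaximallyEntangled Φ) :
    ∃ d, d = min (Fintype.card α) (Fintype.card β) ∧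
      ∃ (a : Matrix α (Fin d) ℂ) (b : Matrix β (Fin d) ℂ), aᴴ * a = 1 ∧ bᴴ * b = 1 ∧
        Φ = (d : ℝ)⁻¹ • ketbra (pvec (a * bᵀ)) := by
  obtain ⟨a, b, ha, hb, rfl⟩ := h
  refine ⟨_, rfl, Matrix.of fun x i => a i x, Matrix.of fun x i => b i x, (orthonormal_columns_iff _).1 ha,
    (orthonormal_columns_iff _).1 hb, ?_⟩
  have : (((min (Fintype.card α) (Fintype.card β) : ℕ) : ℝ)⁻¹) =
      ((Real.sqrt (min (Fintype.card α) (Fintype.card β) : ℕ))⁻¹) ^ 2 := by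
    rw [inv_pow, Real.sq_sqrt (Nat.cast_nonneg _)]
  rw [this, ← ketbra_real_smul]
  congr 1
  ext x
  simp [pvec, Matrix.mul_apply]

lemma IsMaximallyEntangled.isState [Nonempty α] [Nonempty β] {Φ : Matrix (α × β) (α × β) ℂ}
    (h : IsMaximallyEntangled Φ) : IsState Φ := by
  obtain ⟨d, hd, a, b, ha, hb, rfl⟩ := exists_pvec_of_isMaximallyEntangled h
  have hd : (0 : ℝ) < d := by
    rw [hd]; exact_mod_cast lt_min Fintype.card_pos Fintype.card_pos
  have hp := posSemidef_real_smul (posSemidef_ketbra (pvec (a * bᵀ))) (inv_nonneg.2 hd.le)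
  refine ⟨hp, ?_⟩
  have hbt : bᵀ * bᴴᵀ = 1 := by rw [← Matrix.transpose_mul, hb, Matrix.transpose_one]
  have : (a * bᵀ) * (a * bᵀ)ᴴ = a * aᴴ := by
    have e : (bᵀ)ᴴ = bᴴᵀ := by ext; simp
    rw [Matrix.conjTranspose_mul, e, Matrix.mul_assoc, ← Matrix.mul_assoc bᵀ, hbt, Matrix.one_mul]
  rw [trace_eq_re hp, re_trace_real_smul, trace_re_ketbra, norm_pvec_sq, this,
    Matrix.trace_mul_comm, ha, Matrix.trace_one, Fintype.card_fin, Complex.natCast_re,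
    inv_mul_cancel₀ hd.ne', Complex.ofReal_one]

lemma exists_isMaximallyEntangled (α β : Type) [Fintype α] [Fintype β] :
    ∃ φ : EuclideanSpace ℂ (α × β), IsMaximallyEntangled (ketbra φ) := by
  classical
  obtain ⟨f⟩ : Nonempty (Fin (min (Fintype.card α) (Fintype.card β)) ↪ α) :=
    Function.Embedding.nonempty_of_card_le (by simp)
  obtain ⟨g⟩ : Nonempty (Fin (min (Fintype.card α) (Fintype.card β)) ↪ β) :=
    Function.Embedding.nonempty_of_card_le (by simp)
  exact ⟨_, fun i => EuclideanSpace.basisFun α ℂ (f i), fun i => EuclideanSpace.basisFun β ℂ (g i),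
    (EuclideanSpace.basisFun α ℂ).orthonormal.comp f f.injective,
    (EuclideanSpace.basisFun β ℂ).orthonormal.comp g g.injective, rfl⟩

/-- An LOCC transformation of a maximally entangled state to any other pure state. -/
lemma IsEntanglementMonotone.ketbra_le [Nonempty α] [Nonempty β] {E : BipartiteMeasure}
    (hE : IsEntanglementMonotone E) {Φ : Matrix (α × β) (α × β) ℂ} (h : IsMaximallyEntangled Φ)
    {ψ : EuclideanSpace ℂ (α × β)} (hψ : ‖ψ‖ = 1) : E α β (ketbra ψ) ≤ E α β Φ := by
  have hΦ := h.isState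
  obtain ⟨d, hd, a, b, ha, hb, rfl⟩ := exists_pvec_of_isMaximallyEntangled h
  have hσ := isState_ketbra hψ
  rw [eq_pvec ψ] at hψ hσ ⊢
  set A : Matrix α β ℂ := Matrix.of fun x y => ψ (x, y)
  have hd0 : (d : ℝ) ≠ 0 := by
    have : 0 < d := hd ▸ lt_min Fintype.card_pos Fintype.card_pos
    exact_mod_cast this.ne'
  have hAA : (A * Aᴴ).trace = 1 := by
    rw [trace_eq_re (Matrix.posSemidef_self_mul_conjTranspose A), ← norm_pvec_sq, hψ]; simp
  -- Each of the `d` outcomes has probability `1/d`, and `none` has probability `0`.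
  have hp : ∑ x : (Σ _ : Option (Fin d), Σ _ : Unit, Unit),
      (d : ℝ)⁻¹ * (x.1.elim 0 fun _ => 1 : ℝ) ^ 2 = 1 := by
    rw [Fintype.sum_sigma]
    simp [hd0]
  have key : ∀ {M : Option (Fin d) → Matrix α α ℂ} {N : Option (Fin d) → Matrix β β ℂ},
      (∀ j, M j * (a * bᵀ) * (N j)ᵀ = (j.elim 0 fun _ => 1 : ℝ) • A) →
      ∀ x : (Σ _ : Option (Fin d), Σ _ : Unit, Unit),
        (M x.1 ⊗ₖ N x.1) * ((d : ℝ)⁻¹ • ketbra (pvec (a * bᵀ))) * (M x.1 ⊗ₖ N x.1)ᴴ =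
          ((d : ℝ)⁻¹ * (x.1.elim 0 fun _ => 1 : ℝ) ^ 2) • ketbra (pvec A) := fun hMN x => by
    rw [Matrix.mul_smul, Matrix.smul_mul, kronecker_conj_ketbra_pvec, hMN, pvec_real_smul,
      ketbra_real_smul, smul_smul]
  rcases le_total (Fintype.card β) (Fintype.card α) with hc | hc
  · obtain ⟨M, N, hM, hN, hMN⟩ := exists_measurement (by rw [hd, min_eq_right hc]) ha hb
      (A := A) (by rw [Matrix.trace_mul_comm, hAA])
    exact hE.le_of_locc (isLOCC_alice_bob hM hN) hΦ hσ hp (key hMN)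
  -- When the second party is the larger one, the roles are exchanged and the coefficient matrix is
  -- transposed.
  · obtain ⟨N, M, hN, hM, hMN⟩ := exists_measurement (by rw [hd, min_eq_left hc]) hb ha
      (A := Aᵀ) (by
        have : (Aᵀ)ᴴ = Aᴴᵀ := by ext; simp
        rw [this, ← Matrix.transpose_mul, Matrix.trace_transpose, hAA])
    refine hE.le_of_locc (isLOCC_bob_alice hM hN) hΦ hσ hp (key fun j => ?_)
    have := congrArg Matrix.transpose (hMN j)
    simpa only [Matrix.transpose_mul, Matrix.transpose_transpose, Matrix.transpose_smul,
      Matrix.mul_assoc] using this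

/-- A convex entanglement monotone is maximal at the maximally entangled states. -/
lemma IsEntanglementMonotone.isGreatest [Nonempty α] [Nonempty β] {E : BipartiteMeasure}
    (hE : IsEntanglementMonotone E)
    (hconv : ConvexOn ℝ {ρ : Matrix (α × β) (α × β) ℂ | IsState ρ} (E α β))
    {Φ : Matrix (α × β) (α × β) ℂ} (h : IsMaximallyEntangled Φ) :
    IsGreatest {x | ∃ ρ : Matrix (α × β) (α × β) ℂ, IsState ρ ∧ x = E α β ρ} (E α β Φ) := by
  refine ⟨⟨Φ, h.isState, rfl⟩, ?_⟩
  rintro x ⟨ρ, hρ, rfl⟩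
  obtain ⟨m, P, Ψ, hP, hΨ, hP1, rfl⟩ := exists_ensemble hρ
  calc E α β (∑ k, P k • ketbra (Ψ k)) ≤ ∑ k, P k • E α β (ketbra (Ψ k)) :=
        hconv.map_sum_le (fun k _ => hP k) hP1 fun k _ => isState_ketbra (hΨ k)
    _ ≤ ∑ k, P k * E α β Φ := Finset.sum_le_sum fun k _ =>
        mul_le_mul_of_nonneg_left (hE.ketbra_le h (hΨ k)) (hP k)
    _ = E α β Φ := by rw [← Finset.sum_mul, hP1, one_mul]

lemma IsEntanglementMonotone.hasSup [Nonempty α] [Nonempty β] {E : BipartiteMeasure}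
    (hE : IsEntanglementMonotone E)
    (hconv : ConvexOn ℝ {ρ : Matrix (α × β) (α × β) ℂ | IsState ρ} (E α β)) : HasSup α β E := by
  obtain ⟨φ, hφ⟩ := exists_isMaximallyEntangled α β
  have h := hE.isGreatest hconv hφ
  exact ⟨hE.nonneg α β, fun ρ hρ => le_csSup ⟨_, h.2⟩ ⟨ρ, hρ, rfl⟩⟩

end MaxEntangled

/-! ### The convex roof -/

section ConvexRoof

set_option linter.unusedSectionVars false

variable {R : BipartiteMeasure} {α β : Type} [Fintype α] [DecidableEq α] [Fintype β]
  [DecidableEq β]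

/-- The entropy of the reduced state does not increase on average under LOCC measurements of
pure states. -/
lemma IsLOCC.sum_homS_le (hR : HasSup α β R)
    (hconv : ConvexOn ℝ {ρ : Matrix (α × β) (α × β) ℂ | IsState ρ} (R α β))
    {κ μ : Type} [Fintype κ] [DecidableEq κ] [Fintype μ] [DecidableEq μ]
    {q : Type} {outA outB : q → Type} {K : ∀ i, Matrix (outA i × outB i) (κ × μ) ℂ}
    (hK : IsLOCC K) : ∀ [Fintype q] [∀ i, Fintype (outA i)] [∀ i, DecidableEq (outA i)]
      [∀ i, Fintype (outB i)] (ψ : EuclideanSpace ℂ (κ × μ)),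
      ∑ i, homS R α β (ptrace (ketbra (WithLp.toLp 2 (K i *ᵥ ψ.ofLp)))) ≤
        homS R α β (ptrace (ketbra ψ)) := by
  induction hK with
  | nothing κ μ =>
    intro _ iA dA iB ψ
    have e1 : iA () = ‹Fintype κ› := Subsingleton.elim _ _
    have e2 : dA () = ‹DecidableEq κ› := Subsingleton.elim _ _
    have e3 : iB () = ‹Fintype μ› := Subsingleton.elim _ _
    rw [Fintype.sum_unique]
    change @homS κ (iA ()) (dA ()) R α β _ _ _ _ (@ptrace κ μ (iB ()) _) ≤ _
    rw [e1, e2, e3, Matrix.one_mulVec]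
  | @alice κ μ _ _ _ _ r _ γ _ _ M hM s outA outB K hK ih =>
    intro iq iA dA iB ψ
    have : ∀ j, Fintype (s j) := fun j =>
      Fintype.ofInjective (fun i : s j => (⟨j, i⟩ : Σ j, s j)) sigma_mk_injective
    have e : iq = Sigma.instFintype := Subsingleton.elim _ _
    subst e
    rw [eq_pvec ψ]
    set A : Matrix κ μ ℂ := Matrix.of fun x y => ψ (x, y)
    rw [Fintype.sum_sigma]
    calc _ ≤ ∑ j, homS R α β ((M j * A) * (M j * A)ᴴ) := by
          refine Finset.sum_le_sum fun j _ => ?_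
          have h := @ih j _ (fun i => iA ⟨j, i⟩) (fun i => dA ⟨j, i⟩) (fun i => iB ⟨j, i⟩)
            (pvec (M j * A * (1 : Matrix μ μ ℂ)ᵀ))
          rw [ptrace_ketbra_pvec, ← kronecker_mulVec_pvec] at h
          simpa only [Matrix.mulVec_mulVec, Matrix.transpose_one, Matrix.mul_one] using h
      -- Passing to the other marginal: Alice's measurement preserves Bob's marginal `A† A` on
      -- average, so superadditivity applies there.
      _ = ∑ j, homS R α β (Aᴴ * ((M j)ᴴ * M j) * A) := by
          refine Finset.sum_congr rfl fun j _ => ?_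
          rw [homS_mul_conjTranspose, Matrix.conjTranspose_mul]
          simp only [Matrix.mul_assoc]
      _ ≤ homS R α β (∑ j, Aᴴ * ((M j)ᴴ * M j) * A) := Monogamy.sum_homS_le hR hconv fun j =>
          (Matrix.posSemidef_conjTranspose_mul_self (M j)).conjTranspose_mul_mul_same A
      _ = _ := by
          rw [← Matrix.sum_mul, ← Matrix.mul_sum, hM, Matrix.mul_one, ptrace_ketbra_pvec,
            homS_mul_conjTranspose]
  | @bob κ μ _ _ _ _ r _ γ _ _ M hM s outA outB K hK ih =>
    intro iq iA dA iB ψ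
    have : ∀ j, Fintype (s j) := fun j =>
      Fintype.ofInjective (fun i : s j => (⟨j, i⟩ : Σ j, s j)) sigma_mk_injective
    have e : iq = Sigma.instFintype := Subsingleton.elim _ _
    subst e
    rw [eq_pvec ψ]
    set A : Matrix κ μ ℂ := Matrix.of fun x y => ψ (x, y)
    rw [Fintype.sum_sigma]
    -- Transposed completeness: Bob's measurement preserves `A A†` on average, so no change of
    -- marginal is needed.
    have hM' : ∑ j, (M j)ᵀ * ((M j)ᵀ)ᴴ = 1 := by
      have := congrArg Matrix.transpose hM
      rw [Matrix.transpose_sum, Matrix.transpose_one] at this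
      rw [← this]
      refine Finset.sum_congr rfl fun j _ => ?_
      rw [Matrix.transpose_mul]
      rfl
    calc _ ≤ ∑ j, homS R α β ((A * (M j)ᵀ) * (A * (M j)ᵀ)ᴴ) := by
          refine Finset.sum_le_sum fun j _ => ?_
          have h := @ih j _ (fun i => iA ⟨j, i⟩) (fun i => dA ⟨j, i⟩) (fun i => iB ⟨j, i⟩)
            (pvec ((1 : Matrix κ κ ℂ) * A * (M j)ᵀ))
          rw [ptrace_ketbra_pvec, ← kronecker_mulVec_pvec] at h
          simpa only [Matrix.mulVec_mulVec, Matrix.one_mul] using h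
      _ ≤ homS R α β (∑ j, (A * (M j)ᵀ) * (A * (M j)ᵀ)ᴴ) := Monogamy.sum_homS_le hR hconv fun j =>
          Matrix.posSemidef_self_mul_conjTranspose _
      _ = homS R α β (A * (∑ j, (M j)ᵀ * ((M j)ᵀ)ᴴ) * Aᴴ) := by
          rw [Matrix.mul_sum, Matrix.sum_mul]
          simp only [Matrix.conjTranspose_mul, Matrix.mul_assoc]
      _ = _ := by rw [hM', Matrix.mul_one, ptrace_ketbra_pvec]

variable {κ μ : Type} [Fintype κ] [DecidableEq κ] [Fintype μ] [DecidableEq μ]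

lemma bddBelow_convexRoof (hR : HasSup α β R) (ρ : Matrix (κ × μ) (κ × μ) ℂ) :
    0 ∈ lowerBounds {x | ∃ (m : ℕ) (P : Fin m → ℝ) (Ψ : Fin m → EuclideanSpace ℂ (κ × μ)),
      (∀ k, 0 ≤ P k) ∧ (∀ k, ‖Ψ k‖ = 1) ∧ ∑ k, P k • ketbra (Ψ k) = ρ ∧
      x = ∑ k, P k * entS R α β (ptrace (ketbra (Ψ k)))} := by
  rintro x ⟨m, P, Ψ, hP, hΨ, -, rfl⟩
  exact Finset.sum_nonneg fun k _ =>
    mul_nonneg (hP k) (entS_nonneg hR (isState_ketbra (hΨ k)).ptrace)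

lemma homS_ptrace_smul (c : ℝ) (ψ : EuclideanSpace ℂ (κ × μ)) :
    homS R α β (ptrace (ketbra (c • ψ))) = c ^ 2 * homS R α β (ptrace (ketbra ψ)) := by
  rw [eq_pvec ψ, ← pvec_real_smul, ptrace_ketbra_pvec, ptrace_ketbra_pvec, ← homS_smul]
  congr 1
  ext x y
  simp only [Matrix.mul_apply, Matrix.smul_apply, Matrix.conjTranspose_apply, Finset.smul_sum]
  refine Finset.sum_congr rfl fun i _ => ?_
  simp
  ring

/-- The convex roof is bounded by ensembles of vectors that need not be normalized. -/
lemma convexRoof_le (hR : HasSup α β R) [Nonempty (κ × μ)] {ι : Type} [Fintype ι]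
    (φ : ι → EuclideanSpace ℂ (κ × μ)) :
    convexRoof R α β κ μ (∑ k, ketbra (φ k)) ≤ ∑ k, homS R α β (ptrace (ketbra (φ k))) := by
  classical
  have hψ : ∀ k, ∃ ψ : EuclideanSpace ℂ (κ × μ), ‖ψ‖ = 1 ∧ φ k = ‖φ k‖ • ψ := fun k => by
    by_cases h0 : φ k = 0
    -- A zero vector has weight zero, so any unit vector can stand for it.
    · exact ⟨EuclideanSpace.single (Classical.arbitrary _) 1, by simp, by simp [h0]⟩
    · have : ‖φ k‖ ≠ 0 := norm_ne_zero_iff.2 h0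
      refine ⟨‖φ k‖⁻¹ • φ k, ?_, ?_⟩
      · rw [norm_smul, norm_inv, norm_norm, inv_mul_cancel₀ this]
      · rw [smul_smul, mul_inv_cancel₀ this, one_smul]
  choose ψ hψ1 hψ2 using hψ
  let e := (Fintype.equivFin ι).symm
  refine csInf_le ⟨0, bddBelow_convexRoof hR _⟩ ⟨Fintype.card ι, fun k => ‖φ (e k)‖ ^ 2,
    fun k => ψ (e k), fun k => by positivity, fun k => hψ1 _, ?_, ?_⟩
  · rw [e.sum_comp fun k => ‖φ k‖ ^ 2 • ketbra (ψ k)]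
    refine Finset.sum_congr rfl fun k _ => ?_
    conv_rhs => rw [hψ2 k]
    rw [ketbra_real_smul]
  · rw [e.sum_comp fun k => ‖φ k‖ ^ 2 * entS R α β (ptrace (ketbra (ψ k)))]
    refine Finset.sum_congr rfl fun k _ => ?_
    rw [← homS_of_isState (isState_ketbra (hψ1 k)).ptrace]
    conv_lhs => rw [hψ2 k]
    rw [homS_ptrace_smul]

/-- The spectral ensemble shows that the infimum is not over the empty set, where `sInf` would be
`0`. -/
lemma le_convexRoof {ρ : Matrix (κ × μ) (κ × μ) ℂ} (hρ : IsState ρ) {c : ℝ}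
    (h : ∀ (m : ℕ) (P : Fin m → ℝ) (Ψ : Fin m → EuclideanSpace ℂ (κ × μ)), (∀ k, 0 ≤ P k) →
      (∀ k, ‖Ψ k‖ = 1) → ∑ k, P k • ketbra (Ψ k) = ρ →
      c ≤ ∑ k, P k * entS R α β (ptrace (ketbra (Ψ k)))) :
    c ≤ convexRoof R α β κ μ ρ := by
  obtain ⟨m, P, Ψ, hP, hΨ, -, hs⟩ := exists_ensemble hρ
  refine le_csInf ⟨_, m, P, Ψ, hP, hΨ, hs, rfl⟩ ?_
  rintro x ⟨m, P, Ψ, hP, hΨ, hs, rfl⟩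
  exact h m P Ψ hP hΨ hs

lemma convexRoof_nonneg (hR : HasSup α β R) {ρ : Matrix (κ × μ) (κ × μ) ℂ} (hρ : IsState ρ) :
    0 ≤ convexRoof R α β κ μ ρ :=
  le_convexRoof hρ fun m P Ψ hP hΨ hs => bddBelow_convexRoof hR ρ ⟨m, P, Ψ, hP, hΨ, hs, rfl⟩

/-- Every ensemble of `ρ` is mapped by each Kraus operator to an ensemble of that outcome;
exchanging the sums reduces the claim to `IsLOCC.sum_homS_le` for each member. -/
lemma monotoneOnAverage_convexRoof (hR : HasSup α β R)
    (hconv : ConvexOn ℝ {ρ : Matrix (α × β) (α × β) ℂ | IsState ρ} (R α β)) :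
    MonotoneOnAverage (convexRoof R α β) := by
  intro κ μ _ _ _ _ q _ outA outB _ _ _ _ K hK ρ hρ
  refine le_convexRoof hρ fun m P Ψ hP hΨ hs => ?_
  let φ : ∀ i, Fin m → EuclideanSpace ℂ (outA i × outB i) := fun i k =>
    WithLp.toLp 2 (K i *ᵥ (Ψ k).ofLp)
  have hKρ : ∀ i, K i * ρ * (K i)ᴴ = ∑ k, P k • ketbra (φ i k) := fun i => by
    rw [← hs, Matrix.mul_sum, Matrix.sum_mul]
    refine Finset.sum_congr rfl fun k _ => ?_
    rw [Matrix.mul_smul, Matrix.smul_mul, ketbra_mulVec]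
  have hpos : ∀ i k, 0 ≤ homS R α β (ptrace (ketbra (φ i k))) := fun i k =>
    homS_nonneg hR (ptrace_posSemidef (posSemidef_ketbra _))
  have key : ∀ i, ((K i)ᴴ * K i * ρ).trace.re * convexRoof R α β (outA i) (outB i)
      ((((K i)ᴴ * K i * ρ).trace.re)⁻¹ • (K i * ρ * (K i)ᴴ)) ≤
        ∑ k, P k * homS R α β (ptrace (ketbra (φ i k))) := fun i => by
    have hp : (K i * ρ * (K i)ᴴ).PosSemidef := hρ.1.mul_mul_conjTranspose_same (K i)
    have ht : ((K i)ᴴ * K i * ρ).trace.re = (K i * ρ * (K i)ᴴ).trace.re := by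
      rw [Matrix.mul_assoc, Matrix.trace_mul_comm]
    rw [ht]
    set p := (K i * ρ * (K i)ᴴ).trace.re with hpdef
    have hp0 : 0 ≤ p := trace_re_nonneg hp
    rcases eq_or_ne p 0 with h0 | h0
    · rw [h0, zero_mul]
      exact Finset.sum_nonneg fun k _ => mul_nonneg (hP k) (hpos i k)
    have : Nonempty (outA i × outB i) := (isState_inv_smul hp h0).nonempty
    have hsq : ∀ k, Real.sqrt (p⁻¹ * P k) ^ 2 = p⁻¹ * P k := fun k =>
      Real.sq_sqrt (mul_nonneg (inv_nonneg.2 hp0) (hP k))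
    -- These vectors form an unnormalized ensemble of the normalized outcome `i`.
    have hle := convexRoof_le hR fun k => Real.sqrt (p⁻¹ * P k) • φ i k
    simp only [ketbra_real_smul, hsq] at hle
    have e1 : ∑ k, (p⁻¹ * P k) • ketbra (φ i k) = p⁻¹ • (K i * ρ * (K i)ᴴ) := by
      rw [hKρ, Finset.smul_sum]
      simp only [smul_smul]
    have e2 : ∀ k, homS R α β (ptrace ((p⁻¹ * P k) • ketbra (φ i k))) =
        p⁻¹ * (P k * homS R α β (ptrace (ketbra (φ i k)))) := fun k => by
      rw [← hsq, ← ketbra_real_smul, homS_ptrace_smul, hsq, mul_assoc]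
    rw [e1] at hle
    simp only [e2] at hle
    rw [← Finset.mul_sum] at hle
    calc _ ≤ p * (p⁻¹ * ∑ k, P k * homS R α β (ptrace (ketbra (φ i k)))) :=
          mul_le_mul_of_nonneg_left hle hp0
      _ = _ := by rw [← mul_assoc, mul_inv_cancel₀ h0, one_mul]
  calc _ ≤ ∑ i, ∑ k, P k * homS R α β (ptrace (ketbra (φ i k))) :=
        Finset.sum_le_sum fun i _ => key i
    _ = ∑ k, P k * ∑ i, homS R α β (ptrace (ketbra (φ i k))) := by
        rw [Finset.sum_comm]
        simp only [Finset.mul_sum]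
    _ ≤ ∑ k, P k * homS R α β (ptrace (ketbra (Ψ k))) := Finset.sum_le_sum fun k _ =>
        mul_le_mul_of_nonneg_left (hK.sum_homS_le hR hconv (Ψ k)) (hP k)
    _ = _ := Finset.sum_congr rfl fun k _ => by
        rw [homS_of_isState (isState_ketbra (hΨ k)).ptrace]

/-- The entropy vanishes at pure states. -/
lemma entS_ketbra_eq_zero (hR : HasSup α β R) {φ : EuclideanSpace ℂ (α × β)} (hφ : ‖φ‖ = 1)
    (hmax : R α β (ketbra φ) = Rsup R α β) {ψ : EuclideanSpace ℂ κ} (hψ : ‖ψ‖ = 1) :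
    entS R α β (ketbra ψ) = 0 := by
  refine le_antisymm (sub_nonpos.2 ?_) (entS_nonneg hR (isState_ketbra hψ))
  have hn : ∀ {ι : Type} [Fintype ι] {χ : EuclideanSpace ℂ ι}, ‖χ‖ = 1 →
      star χ.ofLp ⬝ᵥ χ.ofLp = 1 := fun {ι} _ {χ} hχ => by
    have := inner_self_eq_norm_sq_to_K (𝕜 := ℂ) χ
    rw [hχ, EuclideanSpace.inner_eq_star_dotProduct, dotProduct_comm] at this
    simpa using this
  -- The operator `|φ⟩⟨ψ|` carries `ψ` to the maximizer `φ`, so `G` reaches `Rsup`.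
  let V : Matrix (α × β) κ ℂ := vecMulVec φ.ofLp (star ψ.ofLp)
  have hV : V *ᵥ ψ.ofLp = φ.ofLp := by
    simp only [V, Matrix.vecMulVec_mulVec, hn hψ, MulOpposite.op_one, one_smul]
  have hV' : Vᴴ *ᵥ φ.ofLp = ψ.ofLp := by
    have : Vᴴ = vecMulVec ψ.ofLp (star φ.ofLp) := by
      simp [V, Matrix.conjTranspose_vecMulVec]
    simp only [this, Matrix.vecMulVec_mulVec, hn hφ, MulOpposite.op_one, one_smul]
  have h := le_entG hR (isState_ketbra hψ) (V := V) (by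
    change Vᴴ * V * vecMulVec ψ.ofLp (star ψ.ofLp) = vecMulVec ψ.ofLp (star ψ.ofLp)
    rw [Matrix.mul_vecMulVec, ← Matrix.mulVec_mulVec, hV, hV'])
  rw [← ketbra_mulVec, hV] at h
  rwa [← hmax]

/-- Decomposing both factors of each product state gives an ensemble of product vectors; their
marginals are pure and have zero entropy. -/
lemma convexRoof_separable (hR : HasSup α β R) {φ : EuclideanSpace ℂ (α × β)} (hφ : ‖φ‖ = 1)
    (hmax : R α β (ketbra φ) = Rsup R α β) {ρ : Matrix (κ × μ) (κ × μ) ℂ} (hρ : IsSeparable ρ) :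
    convexRoof R α β κ μ ρ = 0 := by
  obtain ⟨ι, _, w, z, hw, hw1, hz, hzρ⟩ := mem_convexHull_iff_exists_fintype.1 hρ
  choose σA σB hA hB hAB using hz
  choose mA PA ΨA hPA hΨA hPA1 hsA using fun i => exists_ensemble (hA i)
  choose mB PB ΨB hPB hΨB hPB1 hsB using fun i => exists_ensemble (hB i)
  let A : ∀ i, Fin (mA i) → Fin (mB i) → Matrix κ μ ℂ := fun i k l =>
    vecMulVec (ΨA i k).ofLp (ΨB i l).ofLp
  let c : (Σ i, Fin (mA i) × Fin (mB i)) → ℝ := fun x => w x.1 * (PA x.1 x.2.1 * PB x.1 x.2.2)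
  have hc : ∀ x, 0 ≤ c x := fun x => mul_nonneg (hw _) (mul_nonneg (hPA _ _) (hPB _ _))
  let χ : (Σ i, Fin (mA i) × Fin (mB i)) → EuclideanSpace ℂ (κ × μ) := fun x =>
    Real.sqrt (c x) • pvec (A x.1 x.2.1 x.2.2)
  have hk : ∀ i k l, ketbra (pvec (A i k l)) = ketbra (ΨA i k) ⊗ₖ ketbra (ΨB i l) :=
      fun i k l => by
    ext x y
    simp [ketbra, pvec, A, Matrix.vecMulVec_apply]
    ring
  have hρχ : ρ = ∑ x, ketbra (χ x) := by
    rw [← hzρ, Fintype.sum_sigma]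
    refine Finset.sum_congr rfl fun i _ => ?_
    rw [hAB, ← hsA, ← hsB]
    ext x y
    simp only [Matrix.smul_apply, Matrix.kroneckerMap_apply, Matrix.sum_apply, χ, ketbra_real_smul,
      Real.sq_sqrt (hc _), hk, Finset.sum_mul_sum, Finset.smul_sum, Fintype.sum_prod_type]
    refine Finset.sum_congr rfl fun k _ => Finset.sum_congr rfl fun l _ => ?_
    simp [c]
    ring
  have hst : IsState ρ := by
    refine convexHull_min ?_ ?_ hρ (t := {ρ | IsState ρ})
    · rintro σ ⟨σA, σB, hA, hB, rfl⟩
      refine ⟨hA.1.kronecker hB.1, ?_⟩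
      rw [Matrix.trace_kronecker, hA.2, hB.2, one_mul]
    · intro σ hσ τ hτ a b ha hb hab
      refine ⟨(posSemidef_real_smul hσ.1 ha).add (posSemidef_real_smul hτ.1 hb), ?_⟩
      rw [Matrix.trace_add, Matrix.trace_smul, Matrix.trace_smul, hσ.2, hτ.2, ← add_smul, hab,
        one_smul]
  have := hst.nonempty
  refine le_antisymm ?_ (convexRoof_nonneg hR hst)
  rw [hρχ]
  refine (convexRoof_le hR χ).trans_eq (Finset.sum_eq_zero fun x _ => ?_)
  have hpt : ptrace (ketbra (pvec (A x.1 x.2.1 x.2.2))) = ketbra (ΨA x.1 x.2.1) := by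
    have h1 := (isState_ketbra (hΨB x.1 x.2.2)).2
    ext y y'
    simp only [hk, ptrace, Matrix.of_apply, Matrix.kroneckerMap_apply, ← Finset.mul_sum]
    exact (congrArg _ h1).trans (mul_one _)
  rw [homS_ptrace_smul, hpt, homS_of_isState (isState_ketbra (hΨA _ _)),
    entS_ketbra_eq_zero hR hφ hmax (hΨA _ _), mul_zero]

/-- A pure state is extreme: every member of positive weight in an ensemble of it is the state
itself. -/
lemma convexRoof_ketbra (hR : HasSup α β R) {ψ : EuclideanSpace ℂ (κ × μ)} (hψ : ‖ψ‖ = 1) :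
    convexRoof R α β κ μ (ketbra ψ) = entS R α β (ptrace (ketbra ψ)) := by
  have hst := isState_ketbra hψ
  have := hst.nonempty
  apply le_antisymm
  · have := convexRoof_le hR fun _ : Unit => ψ
    simpa [homS_of_isState hst.ptrace] using this
  · refine le_convexRoof hst fun m P Ψ hP hΨ hs => ?_
    have hP1 : ∑ k, P k = 1 := by
      have := congrArg (fun X => (Matrix.trace X).re) hs
      simpa [Matrix.trace_sum, trace_re_ketbra, hΨ, hψ] using this
    have hk : ∀ k, P k * entS R α β (ptrace (ketbra (Ψ k))) =
        P k * entS R α β (ptrace (ketbra ψ)) := fun k => by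
      rcases (hP k).eq_or_lt with h0 | h0
      · rw [← h0, zero_mul, zero_mul]
      have hQ : (1 - ketbra ψ) * ∑ k, P k • ketbra (Ψ k) = 0 := by
        have hn : star ψ.ofLp ⬝ᵥ ψ.ofLp = 1 := by
          have := hst.2
          rw [dotProduct_comm]; exact this
        have : ketbra ψ * ketbra ψ = ketbra ψ := by
          change vecMulVec ψ.ofLp (star ψ.ofLp) * vecMulVec ψ.ofLp (star ψ.ofLp) =
            vecMulVec ψ.ofLp (star ψ.ofLp)
          rw [Matrix.mul_vecMulVec, Matrix.vecMulVec_mulVec, hn, MulOpposite.op_one, one_smul]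
        rw [hs, Matrix.sub_mul, this, Matrix.one_mul, sub_self]
      have h1 := mul_eq_zero_of_mul_sum
        (fun k _ => posSemidef_real_smul (posSemidef_ketbra (Ψ k)) (hP k)) hQ k (Finset.mem_univ _)
      rw [Matrix.mul_smul] at h1
      have h2 := (smul_eq_zero.1 h1).resolve_left h0.ne'
      rw [Matrix.sub_mul, Matrix.one_mul, sub_eq_zero] at h2
      -- Compression by the rank-one projection `ketbra ψ` yields a multiple of it, and the trace
      -- fixes the factor as `1`.
      have h3 : ketbra ψ * ketbra (Ψ k) * ketbra ψ = (ketbra (Ψ k)) := by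
        have h4 := congrArg Matrix.conjTranspose h2
        rw [Matrix.conjTranspose_mul, (posSemidef_ketbra ψ).1.eq,
          (posSemidef_ketbra (Ψ k)).1.eq] at h4
        rw [← h2, ← h4]
      have h5 : ∃ c : ℂ, ketbra ψ * ketbra (Ψ k) * ketbra ψ = c • ketbra ψ := by
        refine ⟨star ψ.ofLp ⬝ᵥ (ketbra (Ψ k) *ᵥ ψ.ofLp), ?_⟩
        change vecMulVec ψ.ofLp (star ψ.ofLp) * ketbra (Ψ k) * vecMulVec ψ.ofLp (star ψ.ofLp) =
          _ • vecMulVec ψ.ofLp (star ψ.ofLp)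
        rw [Matrix.mul_assoc, Matrix.mul_vecMulVec, Matrix.mul_vecMulVec, Matrix.vecMulVec_mulVec,
          op_smul_eq_smul, Matrix.smul_vecMulVec]
      obtain ⟨c, hc⟩ := h5
      rw [h3] at hc
      have h6 : c = 1 := by
        have := congrArg Matrix.trace hc
        rw [(isState_ketbra (hΨ k)).2, Matrix.trace_smul, hst.2] at this
        simpa using this.symm
      rw [hc, h6, one_smul]
    simp only [hk]
    rw [← Finset.sum_mul, hP1, one_mul]

/-- The marginals of any ensemble add up to the marginal of `ρ`, so superadditivity of `homS` bounds
its average entropy. -/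
lemma convexRoof_le_entS (hR : HasSup α β R)
    (hconv : ConvexOn ℝ {ρ : Matrix (α × β) (α × β) ℂ | IsState ρ} (R α β))
    {ρ : Matrix (κ × μ) (κ × μ) ℂ} (hρ : IsState ρ) :
    convexRoof R α β κ μ ρ ≤ entS R α β (ptrace ρ) := by
  have := hρ.nonempty
  obtain ⟨B, hB⟩ := exists_eq_mul_conjTranspose hρ.1
  let φ : Fin ρ.rank → EuclideanSpace ℂ (κ × μ) := fun k => WithLp.toLp 2 fun x => B x k
  have hs : ρ = ∑ k, ketbra (φ k) := by
    refine hB.trans ?_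
    ext x y
    simp [Matrix.mul_apply, Matrix.sum_apply, ketbra, φ]
  have hpt : ptrace ρ = ∑ k, ptrace (ketbra (φ k)) := by
    refine (congrArg ptrace hs).trans ?_
    ext x y
    simp only [ptrace, Matrix.of_apply, Matrix.sum_apply]
    rw [Finset.sum_comm]
  calc convexRoof R α β κ μ ρ = convexRoof R α β κ μ (∑ k, ketbra (φ k)) := congrArg _ hs
    _ ≤ _ := convexRoof_le hR φ
    _ ≤ _ := sum_homS_le hR hconv fun k => ptrace_posSemidef (posSemidef_ketbra _)
    _ = _ := by rw [← hpt, homS_of_isState hρ.ptrace]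

lemma isEntanglementMonotone_convexRoof [Nonempty α] [Nonempty β]
    (hR : IsEntanglementMonotone R)
    (hconv : ConvexOn ℝ {ρ : Matrix (α × β) (α × β) ℂ | IsState ρ} (R α β)) :
    IsEntanglementMonotone (convexRoof R α β) := by
  have hsup := hR.hasSup hconv
  obtain ⟨φ, hφ⟩ := exists_isMaximallyEntangled α β
  have hmax : R α β (ketbra φ) = Rsup R α β := (hR.isGreatest hconv hφ).csSup_eq.symm
  have hn : ‖φ‖ = 1 := by
    have := hφ.isState.trace_re
    rw [trace_re_ketbra] at this
    exact (pow_eq_one_iff_of_nonneg (norm_nonneg _) two_ne_zero).1 this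
  exact ⟨fun κ μ _ _ _ _ ρ hρ => convexRoof_nonneg hsup hρ,
    fun κ μ _ _ _ _ ρ hρ => convexRoof_separable hsup hn hmax hρ,
    Or.inr (monotoneOnAverage_convexRoof hsup hconv)⟩

/-- The maximum is attained at the purification `pvec B` of `ρA = B B†`. -/
lemma isGovernedBy_convexRoof (hR : HasSup α β R)
    (hconv : ConvexOn ℝ {ρ : Matrix (α × β) (α × β) ℂ | IsState ρ} (R α β)) :
    IsGovernedBy (convexRoof R α β) R α β := by
  intro κ _ _ ρA hA
  constructor
  · obtain ⟨B, hB⟩ := exists_eq_mul_conjTranspose hA.1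
    have hpt : ptrace (ketbra (pvec B)) = ρA := hB.symm
    have hn : ‖pvec B‖ = 1 := by
      have := hA.trace_re
      rw [← hpt, trace_ptrace, trace_re_ketbra] at this
      exact (pow_eq_one_iff_of_nonneg (norm_nonneg _) two_ne_zero).1 this
    exact ⟨_, inferInstance, inferInstance, ketbra (pvec B), isState_ketbra hn, hpt,
      by rw [convexRoof_ketbra hR hn, hpt]⟩
  · rintro x ⟨μ, _, _, ρ, hρ, rfl, rfl⟩
    exact convexRoof_le_entS hR hconv hρ

end ConvexRoof

/-! ### Relabelling -/

section Relabel

set_option linter.unusedSectionVars false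

variable {κ μ : Type} [Fintype κ] [Fintype μ] [DecidableEq κ] [DecidableEq μ]

lemma IsState.submatrix {ρ : Matrix κ κ ℂ} (h : IsState ρ) (e : μ ≃ κ) :
    IsState (ρ.submatrix e e) := by
  refine ⟨h.1.submatrix e, ?_⟩
  rw [← h.2]
  exact Fintype.sum_equiv e _ _ fun _ => rfl

lemma relabel_conjTranspose_mul (e : μ ≃ κ) :
    ((1 : Matrix κ κ ℂ).submatrix e id)ᴴ * (1 : Matrix κ κ ℂ).submatrix e id = 1 := by
  rw [Matrix.conjTranspose_submatrix, Matrix.submatrix_mul_equiv]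
  simp

lemma relabel_mul_mul (e : μ ≃ κ) (ρ : Matrix κ κ ℂ) :
    (1 : Matrix κ κ ℂ).submatrix e id * ρ * ((1 : Matrix κ κ ℂ).submatrix e id)ᴴ =
      ρ.submatrix e e := by
  ext x y
  simp [Matrix.mul_apply, Matrix.one_apply]

variable {α β α' β' : Type} [Fintype α] [DecidableEq α] [Fintype β] [DecidableEq β]
  [Fintype α'] [DecidableEq α'] [Fintype β'] [DecidableEq β']

/-- A relabelling is unitary, hence one of the competitors `V`; it need not respect any tensor
structure of `κ`. -/
lemma relabel_le_entG {R : BipartiteMeasure} (hR : HasSup α β R) {ρ : Matrix κ κ ℂ}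
    (h : IsState ρ) (e : α × β ≃ κ) : R α β (ρ.submatrix e e) ≤ entG R α β ρ := by
  rw [← relabel_mul_mul]
  exact le_entG hR h (by rw [relabel_conjTranspose_mul, Matrix.one_mul])

/-- Local relabellings are local operations. -/
lemma IsEntanglementMonotone.relabel_le {E : BipartiteMeasure} (hE : IsEntanglementMonotone E)
    {ρ : Matrix (α × β) (α × β) ℂ} (h : IsState ρ) (e : α' ≃ α) (f : β' ≃ β) :
    E α' β' (ρ.submatrix (e.prodCongr f) (e.prodCongr f)) ≤ E α β ρ := by
  refine hE.le_of_locc (isLOCC_alice_bob (r := Unit) (M := fun _ => (1 : Matrix α α ℂ).submatrix e id)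
    (N := fun _ => (1 : Matrix β β ℂ).submatrix f id) ?_ fun _ => relabel_conjTranspose_mul f)
    h (h.submatrix _) (p := fun _ => 1) ?_ fun _ => ?_
  · rw [Fintype.sum_unique, relabel_conjTranspose_mul]
  · rw [Fintype.sum_sigma]; simp
  · have : (1 : Matrix α α ℂ).submatrix e id ⊗ₖ (1 : Matrix β β ℂ).submatrix f id =
        (1 : Matrix (α × β) (α × β) ℂ).submatrix (e.prodCongr f) id := by
      rw [← Matrix.one_kronecker_one]; rfl
    rw [this, relabel_mul_mul, one_smul]

lemma IsGovernedBy.le {E R : BipartiteMeasure} (h : IsGovernedBy E R α β)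
    {ρ : Matrix (κ × μ) (κ × μ) ℂ} (hρ : IsState ρ) : E κ μ ρ ≤ entS R α β (ptrace ρ) :=
  (h κ (ptrace ρ) hρ.ptrace).2 ⟨μ, inferInstance, inferInstance, ρ, hρ, rfl, rfl⟩

/-- The monogamy inequality for an arbitrary identification of `κ` with `α × β`. -/
lemma IsGovernedBy.add_le {E R : BipartiteMeasure} (h : IsGovernedBy E R α β)
    (hR : IsEntanglementMonotone R) (hconv : IsConvexMeasure R)
    {ρ : Matrix (κ × μ) (κ × μ) ℂ} (hρ : IsState ρ) (e : α × β ≃ κ) :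
    R α β ((ptrace ρ).submatrix e e) + E κ μ ρ ≤ Rsup R α β := by
  obtain ⟨a, b⟩ := (hρ.ptrace.submatrix e).nonempty.some
  have : Nonempty α := ⟨a⟩
  have : Nonempty β := ⟨b⟩
  have h1 := h.le hρ
  have h2 := relabel_le_entG (hR.hasSup (hconv α β)) hρ.ptrace e
  rw [entS] at h1
  linarith

end Relabel

/-! ### Several parts -/

section Parts

set_option linter.unusedSectionVars false

variable {N : ℕ} {α : Fin N → Type} [∀ k, Fintype (α k)] [∀ k, DecidableEq (α k)]

lemma IsState.pairState {ρ : Matrix (∀ k, α k) (∀ k, α k) ℂ} (h : IsState ρ) (i : Fin N)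
    (k : {k : Fin N // k ≠ i}) : IsState (pairState ρ i k) :=
  ((h.submatrix _).submatrix _).ptrace

/-- The other parts of two pairs of the same parts. -/
def othersEquiv (α : Fin N → Type) {i k : Fin N} (hki : k ≠ i) :
    (∀ l : {l : {m : Fin N // m ≠ k} // l ≠ ⟨i, hki.symm⟩}, α l) ≃
      (∀ l : {l : {m : Fin N // m ≠ i} // l ≠ ⟨k, hki⟩}, α l) where
  toFun z l := z ⟨⟨l.1.1, fun h => l.2 (Subtype.ext h)⟩, fun h => l.1.2 (congrArg Subtype.val h)⟩
  invFun z l := z ⟨⟨l.1.1, fun h => l.2 (Subtype.ext h)⟩, fun h => l.1.2 (congrArg Subtype.val h)⟩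
  left_inv _ := rfl
  right_inv _ := rfl

/-- Both sides sum the same entries of `ρ` once the traced-out parts are matched by `othersEquiv`.
-/
lemma pairState_swap (ρ : Matrix (∀ k, α k) (∀ k, α k) ℂ) {i k : Fin N} (hki : k ≠ i) :
    pairState ρ k ⟨i, hki.symm⟩ = (pairState ρ i ⟨k, hki⟩).submatrix Prod.swap Prod.swap := by
  have key : ∀ (x : α k) (y : α i) (z : ∀ l : {l : {m : Fin N // m ≠ k} // l ≠ ⟨i, hki.symm⟩}, α l),
      (Equiv.piSplitAt k α).symm (pairEquiv α k ⟨i, hki.symm⟩ ((x, y), z)) =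
        (Equiv.piSplitAt i α).symm (pairEquiv α i ⟨k, hki⟩ ((y, x), othersEquiv α hki z)) := by
    intro x y z
    funext m
    by_cases hi : m = i
    · subst hi
      simp [pairEquiv, hki.symm]
    · by_cases hk : m = k
      · subst hk
        simp [pairEquiv, hki]
      · simp [pairEquiv, hi, hk, othersEquiv]
  ext ⟨x, y⟩ ⟨x', y'⟩
  refine Fintype.sum_equiv (othersEquiv α hki) _ _ fun z => ?_
  simp only [splitAt, Matrix.submatrix_apply, key, Prod.swap_prod_mk]

lemma IsSymmetricMeasure.pairState_comm {E : BipartiteMeasure} (hE : IsSymmetricMeasure E)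
    {ρ : Matrix (∀ k, α k) (∀ k, α k) ℂ} (hρ : IsState ρ) {i k : Fin N} (hki : k ≠ i) :
    E (α k) (α i) (pairState ρ k ⟨i, hki.symm⟩) = E (α i) (α k) (pairState ρ i ⟨k, hki⟩) := by
  rw [pairState_swap ρ hki]
  exact hE _ _ _ (hρ.pairState i ⟨k, hki⟩)

/-- Each pair of three parts is counted twice in the sum over the distinguished part. -/
lemma IsSymmetricMeasure.sum_pairState {E : BipartiteMeasure} (hE : IsSymmetricMeasure E)
    {α : Fin 3 → Type} [∀ k, Fintype (α k)] [∀ k, DecidableEq (α k)]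
    {ρ : Matrix (∀ k, α k) (∀ k, α k) ℂ} (hρ : IsState ρ) :
    ∑ i, ∑ k : {k : Fin 3 // k ≠ i}, E (α i) (α k) (pairState ρ i k) =
      2 * (E (α 0) (α 1) (pairState ρ 0 ⟨1, by decide⟩) +
        E (α 0) (α 2) (pairState ρ 0 ⟨2, by decide⟩) +
        E (α 1) (α 2) (pairState ρ 1 ⟨2, by decide⟩)) := by
  have e0 : (Finset.univ : Finset {k : Fin 3 // k ≠ 0}) =
    {⟨1, by decide⟩, ⟨2, by decide⟩} := by decide
  have e1 : (Finset.univ : Finset {k : Fin 3 // k ≠ 1}) =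
    {⟨0, by decide⟩, ⟨2, by decide⟩} := by decide
  have e2 : (Finset.univ : Finset {k : Fin 3 // k ≠ 2}) =
    {⟨0, by decide⟩, ⟨1, by decide⟩} := by decide
  rw [Fin.sum_univ_three, e0, e1, e2, Finset.sum_pair (by decide), Finset.sum_pair (by decide),
    Finset.sum_pair (by decide)]
  have h1 := hE.pairState_comm hρ (i := 0) (k := 1) (by decide)
  have h2 := hE.pairState_comm hρ (i := 0) (k := 2) (by decide)
  have h3 := hE.pairState_comm hρ (i := 1) (k := 2) (by decide)
  simp only at h1 h2 h3 ⊢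
  rw [h1, h2, h3]
  ring

lemma IsGovernedBy.sum_add_le {E R : BipartiteMeasure} {i : Fin N}
    (h : IsGovernedBy E R (α i) (Rest α i)) (hR : IsEntanglementMonotone R)
    (hconv : IsConvexMeasure R) {μ : Type} [Fintype μ] [DecidableEq μ]
    {ρ : Matrix ((∀ k, α k) × μ) ((∀ k, α k) × μ) ℂ} (hρ : IsState ρ)
    (hmon : UsualMonogamyAt R (ptrace ρ) i) :
    ∑ k : {k : Fin N // k ≠ i}, R (α i) (α k) (Monogamy.pairState (ptrace ρ) i k)
      + E (∀ k, α k) μ ρ ≤ Rsup R (α i) (Rest α i) :=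
  (add_le_add_left hmon _).trans (h.add_le hR hconv hρ (Equiv.piSplitAt i α).symm)

/-- For parts of equal dimensions, one governed monotone serves all the choices of the
distinguished part. -/
lemma IsGovernedBy.sum_add_le_of_card_eq {E R : BipartiteMeasure} {i j : Fin N}
    (h : IsGovernedBy E R (α i) (Rest α i)) (hR : IsEntanglementMonotone R)
    (hconv : IsConvexMeasure R) (hcard : ∀ k l, Fintype.card (α k) = Fintype.card (α l))
    {μ : Type} [Fintype μ] [DecidableEq μ]
    {ρ : Matrix ((∀ k, α k) × μ) ((∀ k, α k) × μ) ℂ} (hρ : IsState ρ)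
    (hmon : UsualMonogamyAt R (ptrace ρ) j) :
    ∑ k : {k : Fin N // k ≠ j}, R (α j) (α k) (Monogamy.pairState (ptrace ρ) j k)
      + E (∀ k, α k) μ ρ ≤ Rsup R (α i) (Rest α i) := by
  let e : α i ≃ α j := Fintype.equivOfCardEq (hcard i j)
  let f : Rest α i ≃ Rest α j := Fintype.equivOfCardEq (by
    simp [Fintype.card_pi, hcard _ i])
  -- The cut at part `j` is presented with the labels of the cut at `i`, where `E` is governed. The
  -- local relabelling in `h2` then leads back to `splitAt` at `j`.
  let g : α i × Rest α i ≃ ∀ k, α k := (e.prodCongr f).trans (Equiv.piSplitAt j α).symm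
  have h1 := h.add_le hR hconv hρ g
  have hs : IsState ((ptrace ρ).submatrix g g) := hρ.ptrace.submatrix g
  have h2 := hR.relabel_le hs e.symm f.symm
  have h3 : ((ptrace ρ).submatrix g g).submatrix (e.symm.prodCongr f.symm)
      (e.symm.prodCongr f.symm) = splitAt (ptrace ρ) j := by
    have : ∀ x, g (e.symm.prodCongr f.symm x) = (Equiv.piSplitAt j α).symm x := fun x => by
      simp only [g, Equiv.trans_apply]
      exact congrArg _ (Prod.ext (e.apply_symm_apply _) (f.apply_symm_apply _))
    ext x y
    simp only [splitAt, Matrix.submatrix_apply, this]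
  rw [h3] at h2
  have h4 : _ ≤ _ := hmon
  linarith

end Parts

end Monogamy

end

/-! ### Assembly of the statements -/

theorem mainTheorem5 (Et : Monogamy.BipartiteMeasure)
    (hEt : Monogamy.IsEntanglementMonotone Et) (hconv : Monogamy.IsConvexMeasure Et) :
    -- the maximum of `Et` exists and is reached at every maximally entangled state
    (∀ (α β : Type) [Fintype α] [DecidableEq α] [Fintype β] [DecidableEq β]
      [Nonempty α] [Nonempty β] (Φ : Matrix (α × β) (α × β) ℂ),
      Monogamy.IsMaximallyEntangled Φ →
        Monogamy.IsState Φ ∧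
        IsGreatest {x | ∃ ρ : Matrix (α × β) (α × β) ℂ, Monogamy.IsState ρ ∧ x = Et α β ρ}
          (Et α β Φ) ∧
        Monogamy.Rsup Et α β = Et α β Φ) ∧
    -- the convex roof is an entanglement monotone governed by the entropy of `Et`
    (∀ (α β : Type) [Fintype α] [DecidableEq α] [Fintype β] [DecidableEq β]
      [Nonempty α] [Nonempty β],
      Monogamy.IsEntanglementMonotone (Monogamy.convexRoof Et α β) ∧
      Monogamy.IsGovernedBy (Monogamy.convexRoof Et α β) Et α β) ∧
    -- the monogamy inequality for `A = A₁A₂` and `B`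
    (∀ (α β : Type) [Fintype α] [DecidableEq α] [Fintype β] [DecidableEq β]
      (E : Monogamy.BipartiteMeasure), Monogamy.IsEntanglementMonotone E →
      Monogamy.IsGovernedBy E Et α β →
      ∀ (μ : Type) [Fintype μ] [DecidableEq μ] (ρ : Matrix ((α × β) × μ) ((α × β) × μ) ℂ),
        Monogamy.IsState ρ →
        Et α β (Monogamy.ptrace ρ) + E (α × β) μ ρ ≤ Monogamy.Rsup Et α β) ∧
    -- `N` subsystems of `A`
    (∀ (N : ℕ) (α : Fin N → Type) [∀ k, Fintype (α k)] [∀ k, DecidableEq (α k)] (i : Fin N)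
      (E : Monogamy.BipartiteMeasure), Monogamy.IsEntanglementMonotone E →
      Monogamy.IsGovernedBy E Et (α i) (Monogamy.Rest α i) →
      ∀ (μ : Type) [Fintype μ] [DecidableEq μ]
        (ρ : Matrix ((∀ k, α k) × μ) ((∀ k, α k) × μ) ℂ),
        Monogamy.IsState ρ → Monogamy.UsualMonogamyAt Et (Monogamy.ptrace ρ) i →
        ∑ k : {k : Fin N // k ≠ i},
            Et (α i) (α k) (Monogamy.pairState (Monogamy.ptrace ρ) i k)
          + E (∀ k, α k) μ ρ ≤ Monogamy.Rsup Et (α i) (Monogamy.Rest α i)) ∧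
    -- three subsystems of equal dimensions
    (∀ (α : Fin 3 → Type) [∀ k, Fintype (α k)] [∀ k, DecidableEq (α k)],
      Monogamy.IsSymmetricMeasure Et →
      (∀ k l, Fintype.card (α k) = Fintype.card (α l)) →
      ∀ E : Monogamy.BipartiteMeasure, Monogamy.IsEntanglementMonotone E →
      Monogamy.IsGovernedBy E Et (α 0) (Monogamy.Rest α 0) →
      ∀ (μ : Type) [Fintype μ] [DecidableEq μ]
        (ρ : Matrix ((∀ k, α k) × μ) ((∀ k, α k) × μ) ℂ),
        Monogamy.IsState ρ → (∀ i, Monogamy.UsualMonogamyAt Et (Monogamy.ptrace ρ) i) →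
        (2 / 3 : ℝ) *
            (Et (α 0) (α 1) (Monogamy.pairState (Monogamy.ptrace ρ) 0 ⟨1, by decide⟩) +
              Et (α 0) (α 2) (Monogamy.pairState (Monogamy.ptrace ρ) 0 ⟨2, by decide⟩) +
              Et (α 1) (α 2) (Monogamy.pairState (Monogamy.ptrace ρ) 1 ⟨2, by decide⟩))
          + E (∀ k, α k) μ ρ ≤ Monogamy.Rsup Et (α 0) (Monogamy.Rest α 0)) ∧
    -- three subsystems of any dimensions, one monotone for each choice of the distinguished part
    (∀ (α : Fin 3 → Type) [∀ k, Fintype (α k)] [∀ k, DecidableEq (α k)],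
      Monogamy.IsSymmetricMeasure Et →
      ∀ E : Fin 3 → Monogamy.BipartiteMeasure,
      (∀ i, Monogamy.IsEntanglementMonotone (E i)) →
      (∀ i, Monogamy.IsGovernedBy (E i) Et (α i) (Monogamy.Rest α i)) →
      ∀ (μ : Type) [Fintype μ] [DecidableEq μ]
        (ρ : Matrix ((∀ k, α k) × μ) ((∀ k, α k) × μ) ℂ),
        Monogamy.IsState ρ → (∀ i, Monogamy.UsualMonogamyAt Et (Monogamy.ptrace ρ) i) →
        (2 / 3 : ℝ) *
            (Et (α 0) (α 1) (Monogamy.pairState (Monogamy.ptrace ρ) 0 ⟨1, by decide⟩) +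
              Et (α 0) (α 2) (Monogamy.pairState (Monogamy.ptrace ρ) 0 ⟨2, by decide⟩) +
              Et (α 1) (α 2) (Monogamy.pairState (Monogamy.ptrace ρ) 1 ⟨2, by decide⟩))
          + (1 / 3 : ℝ) * ∑ i, E i (∀ k, α k) μ ρ
          ≤ (1 / 3 : ℝ) * ∑ i, Monogamy.Rsup Et (α i) (Monogamy.Rest α i)) := by
  refine ⟨fun α β _ _ _ _ _ _ Φ hΦ => ?_, fun α β _ _ _ _ _ _ => ?_,
    fun α β _ _ _ _ E _ hgov μ _ _ ρ hρ => ?_, fun N α _ _ i E _ hgov μ _ _ ρ hρ hmon => ?_,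
    fun α _ _ hsymm hcard E _ hgov μ _ _ ρ hρ hmon => ?_,
    fun α _ _ hsymm E _ hgov μ _ _ ρ hρ hmon => ?_⟩
  · have h := hEt.isGreatest (hconv α β) hΦ
    exact ⟨hΦ.isState, h, h.csSup_eq⟩
  · exact ⟨Monogamy.isEntanglementMonotone_convexRoof hEt (hconv α β),
      Monogamy.isGovernedBy_convexRoof (hEt.hasSup (hconv α β)) (hconv α β)⟩
  · exact hgov.add_le hEt hconv hρ (Equiv.refl _)
  · exact hgov.sum_add_le hEt hconv hρ hmon
  -- Summing over the three distinguished parts counts each pair twice and `E` three times; division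
  -- by `3` gives the factor `2/3`.
  · have h := Finset.sum_le_sum fun i (_ : i ∈ Finset.univ) =>
      hgov.sum_add_le_of_card_eq hEt hconv hcard hρ (hmon i)
    rw [Finset.sum_add_distrib, hsymm.sum_pairState hρ.ptrace] at h
    simp only [Finset.sum_const, Finset.card_univ, Fintype.card_fin, nsmul_eq_mul] at h
    push_cast at h
    linarith
  · have h := Finset.sum_le_sum fun i (_ : i ∈ Finset.univ) =>
      (hgov i).sum_add_le hEt hconv hρ (hmon i)
    rw [Finset.sum_add_distrib, hsymm.sum_pairState hρ.ptrace] at h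
    linarith
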